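/- Notation. Let $V=\mathbb F_2^n$ with Hamming weight $\mathrm{wt}$ and Hamming distance $d_H$; on $\mathbb C^V$ put $|s\rangle_F=2^{-n/2}\sum_{x\in V}(-1)^{s\cdot x}|x\rangle$ and $Z^\omega|x\rangle=(-1)^{\omega\cdot x}|x\rangle$ for $s,\omega\in V$. For $S\subseteq V$ the Fourier-support code is $\mathcal C(S)=\mathrm{span}\{|s\rangle_F:s\in S\}$; its logical dimension is $\dim\mathcal C(S)=|S|$, and the support $S$ is called affine if $S=v+U$ with $U\le V$ a linear subspace. For $\Omega\subseteq V$, $\mathcal C(S)$ corrects $\Omega$ if one quantum operation (trace-preserving, completely positive) restores all states of $\mathcal C(S)$ after each error $Z^\omega$, $\omega\in\Omega$. Let $K_{\max}(\Omega)$ be the largest logical dimension of a Fourier-support code that corrects $\Omega$. Let $d(S)=\min\{d_H(x,y):x\ne y\in S\}$ (with $d(S)=\infty$ if $|S|\le 1$), let $A_2(n,d)$ and $B_2(n,d)$ be the largest cardinality of a subset, respectively of a linear subspace, of $V$ of minimum distance at least $d$, and let $E_t=\{\omega\in V:\mathrm{wt}(\omega)\le t\}$ and $K_{\max}(n,t)=K_{\max}(E_t)$.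 Theorem. Let $n,t\ge 0$ be integers. (i) (Uniform phase noise.) $K_{\max}(n,t)=A_2(n,2t+1)$. If $A_2(n,2t+1)>B_2(n,2t+1)$, then some non-affine $S$ for which $\mathcal C(S)$ corrects $E_t$ has a logical dimension strictly larger than that of every $\mathcal C(S')$ with affine $S'$ that corrects $E_t$. For the parameters $n=8$, $t=1$, with required distance $d=3$, $B_2(8,3)=16$ and $A_2(8,3)=20$. For $n=16$, $t=2$, with required distance $d=6$, $B_2(16,6)=128$ and $A_2(16,6)=256$: there is a non-affine $S\subseteq\mathbb F_2^{16}$ with $d(S)\ge 6$ such that $\mathcal C(S)$ corrects $E_2$ and has logical dimension $256$, while every affine $S'\subseteq\mathbb F_2^{16}$ with $d(S')\ge 6$ gives logical dimension at most $128$. (ii) (Correlated phase noise.) Let $e_1,\dots,e_n$ be the standard basis of $V$, with indices modulo $n$, let $\Omega_{\mathrm{corr}}=\{0\}\cup\{e_i\}_{i}\cup\{e_i+e_{i+1}\}_{i}$, and let $G_{\mathrm{corr}}=\mathrm{Cay}\bigl(V,(\Omega_{\mathrm{corr}}-\Omega_{\mathrm{corr}})\setminus\{0\}\bigr)$. Then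 $K_{\max}(\Omega_{\mathrm{corr}})=\alpha(G_{\mathrm{corr}})$, the independence number. For $n=8$, $\alpha(G_{\mathrm{corr}})=9$, so that $K_{\max}$ drops from $K_{\max}(8,1)=20$ to $K_{\max}(\Omega_{\mathrm{corr}})=9$; moreover $\Omega_{\mathrm{corr}}-\Omega_{\mathrm{corr}}$ then contains a $3$-dimensional linear subspace, and $K_{\max}(\Omega_{\mathrm{corr}})\le 2^{8-3}$. (iii) (Threshold preservation.) For every $S\subseteq V$, $\mathcal C(S)$ corrects $E_t$ if and only if $d(S)\ge 2t+1$; if $S\ne\varnothing$, this is also equivalent to $(S-S)\cap E_{2t}=\{0\}$. Let $r(S)$ be the largest $r\le n$ such that $\mathcal C(S)$ corrects $E_r$, and for $p\in[0,1]$ let $P_S(p)$ be the probability that, when each qubit suffers a phase flip independently with probability $p$, at most $r(S)$ flips occur. Then $P_S(p)=\sum_{j=0}^{r(S)}\binom nj p^j(1-p)^{n-j}$, and if $S,S'\subseteq V$ satisfy the same conditions $d\ge 2r+1$ (that is, $d(S)\ge 2r+1\iff d(S')\ge 2r+1$ for all integers $r\ge 0$), then $P_S=P_{S'}$ on $[0,1]$.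 -/

import Mathlib

namespace CatQubit

open scoped Pointwise InnerProductSpace

noncomputable section

/-- The group `V = 𝔽₂ⁿ` that labels basis states and phase errors. -/
abbrev V (n : ℕ) : Type := Fin n → ZMod 2

/-- The `n`-qubit Hilbert space `ℂ^V`. -/
abbrev Hilb (n : ℕ) : Type := EuclideanSpace ℂ (V n)

/-- The Fourier basis vector `|s⟩_F = 2^{-n/2} ∑ₓ ζ^{s·x} |x⟩`, with `ζ = e^{2πi/2} = -1`. -/
def fourierVec {n : ℕ} (s : V n) : Hilb n :=
  WithLp.toLp 2 fun x => ((1 / Real.sqrt (2 ^ n) : ℝ) : ℂ) * ZMod.stdAddChar (s ⬝ᵥ x)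

/-- The diagonal phase operator `Z^ω |x⟩ = ζ^{ω·x} |x⟩`. -/
def phaseOp {n : ℕ} (ω : V n) : Hilb n →L[ℂ] Hilb n :=
  Matrix.toEuclideanCLM (n := V n) (𝕜 := ℂ) (Matrix.diagonal fun x => ZMod.stdAddChar (ω ⬝ᵥ x))

/-- The family of phase errors `{Z^ω : ω ∈ Ω}`. -/
def phaseErrors {n : ℕ} (Ω : Set (V n)) : Set (Hilb n →L[ℂ] Hilb n) :=
  phaseOp '' Ω

/-- The Fourier-support code `C(S)`, the span of the `|s⟩_F` with `s ∈ S`. -/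
def fourierCode {n : ℕ} (S : Set (V n)) : Submodule ℂ (Hilb n) :=
  Submodule.span ℂ (fourierVec '' S)

/-- The logical dimension of `C(S)`, i.e. its dimension as a complex vector space (it is `|S|`). -/
def logicalDim {n : ℕ} (S : Set (V n)) : ℕ :=
  Module.finrank ℂ (fourierCode S)

/-- The action `ρ ↦ ∑ₖ Rₖ ρ Rₖ†` of a finite family of Kraus operators. -/
def krausMap {H : Type*} [NormedAddCommGroup H] [InnerProductSpace ℂ H] [CompleteSpace H]
    {m : ℕ} (R : Fin m → H →L[ℂ] H) (ρ : H →L[ℂ] H) : H →L[ℂ] H :=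
  ∑ k, R k ∘L ρ ∘L (R k).adjoint

/-- The code `C` exactly corrects the family `ℰ` of errors: there is one recovery operation (a
trace-preserving completely positive map, given by Kraus operators) that, for every error `E ∈ ℰ`,
maps `E |ψ⟩⟨ψ| E†` back to a multiple `c_E |ψ⟩⟨ψ|`, for all states `ψ` of the code. (For unitary
`E` preservation of the trace forces `c_E = 1` as soon as `C ≠ 0`.) -/
def ExactlyCorrects {H : Type*} [NormedAddCommGroup H] [InnerProductSpace ℂ H] [CompleteSpace H]
    (C : Submodule ℂ H) (ℰ : Set (H →L[ℂ] H)) : Prop :=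
  ∃ (m : ℕ) (R : Fin m → H →L[ℂ] H),
    ∑ k, (R k).adjoint ∘L R k = ContinuousLinearMap.id ℂ H ∧
    ∀ E ∈ ℰ, ∃ c : ℂ, ∀ ψ ∈ C,
      krausMap R (E ∘L InnerProductSpace.rankOne ℂ ψ ψ ∘L E.adjoint)
        = c • InnerProductSpace.rankOne ℂ ψ ψ

/-- `C(S)` exactly corrects all phase errors `Z^ω`, `ω ∈ Ω`. -/
def CorrectsPhase {n : ℕ} (S Ω : Set (V n)) : Prop :=
  ExactlyCorrects (fourierCode S) (phaseErrors Ω)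

/-- `K_max(Ω)`: the largest logical dimension of a Fourier-support code that exactly corrects the
phase errors in `Ω`. (The set is bounded by `2ⁿ`, and contains `0` through `S = ∅`.) -/
def maxLogicalDim {n : ℕ} (Ω : Set (V n)) : ℕ :=
  sSup {K | ∃ S : Set (V n), CorrectsPhase S Ω ∧ logicalDim S = K}

/-- `E_t`, the vectors of Hamming weight at most `t`. -/
def weightBall (n t : ℕ) : Set (V n) :=
  {ω | hammingNorm ω ≤ t}

/-- The minimum distance `d(S)`, with value `∞` when `S` has at most one element. -/
def minDist {n : ℕ} (S : Set (V n)) : ℕ∞ :=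
  ⨅ x ∈ S, ⨅ y ∈ S, ⨅ _ : x ≠ y, (hammingDist x y : ℕ∞)

/-- `A₂(n, d)`: the largest size of a binary code of length `n` and minimum distance at least `d`. -/
def maxCodeSize (n d : ℕ) : ℕ :=
  sSup {K | ∃ S : Set (V n), (d : ℕ∞) ≤ minDist S ∧ S.ncard = K}

/-- `B₂(n, d)`: the same maximum over linear codes. -/
def maxLinearCodeSize (n d : ℕ) : ℕ :=
  sSup {K | ∃ U : Submodule (ZMod 2) (V n),
    (d : ℕ∞) ≤ minDist (U : Set (V n)) ∧ (U : Set (V n)).ncard = K}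

/-- `S = v + U` for a linear subspace `U` of `𝔽₂ⁿ`. -/
def IsAffineSupport {n : ℕ} (S : Set (V n)) : Prop :=
  ∃ (v : V n) (U : Submodule (ZMod 2) (V n)), S = (fun u => v + u) '' (U : Set (V n))

/-- The additive Cayley graph `Cay(𝔽₂ⁿ, (Ω - Ω) \ {0})`. -/
def noiseGraph {n : ℕ} (Ω : Set (V n)) : SimpleGraph (V n) :=
  SimpleGraph.addCayley ((Ω - Ω) \ {0})

/-- `Ω_corr`: no error, one phase flip `e_i`, or two flips `e_i + e_{i+1}` on neighbouring qubits
of a ring of `n` qubits (`finRotate n i` is `i + 1` modulo `n`). -/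
def corrErrors (n : ℕ) : Set (V n) :=
  {0} ∪ Set.range (fun i : Fin n => (Pi.single i 1 : V n)) ∪
    Set.range (fun i : Fin n => (Pi.single i 1 + Pi.single (finRotate n i) 1 : V n))

/-- The maximal number `t ≤ n` of phase flips such that `C(S)` exactly corrects all phase errors
on at most `t` qubits. (`t = 0` always qualifies.) -/
def correctionRadius {n : ℕ} (S : Set (V n)) : ℕ :=
  sSup {t | t ≤ n ∧ CorrectsPhase S (weightBall n t)}

/-- The probability of the error vector `ω` when each qubit suffers a phase flip independently with
probability `p`. -/
def errorProb {n : ℕ} (p : ℝ) (ω : V n) : ℝ :=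
  ∏ i, if ω i = 0 then 1 - p else p

open scoped Classical in
/-- The threshold probability of `C(S)`: the probability, under independent phase flips with
probability `p`, that the number of flips is at most the number that `C(S)` corrects. -/
def thresholdProb {n : ℕ} (S : Set (V n)) (p : ℝ) : ℝ :=
  ∑ ω : V n with ω ∈ weightBall n (correctionRadius S), errorProb p ω

/-- `P_corr(n, t, p) = ∑_{j ≤ t} C(n, j) p^j (1 - p)^{n - j}`. -/
def corrProb (n t : ℕ) (p : ℝ) : ℝ :=
  ∑ j ∈ Finset.range (t + 1), (n.choose j : ℝ) * p ^ j * (1 - p) ^ (n - j)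

end

end CatQubit

open CatQubit
open scoped Pointwise

/-! In the Fourier basis the error Z^ω translates labels by ω (`phaseOp_fourierVec`), so exact
correction is a combinatorial condition: by `correctsPhase_iff` the translates ω + S with ω ∈ Ω must
be pairwise disjoint. If two of them meet, one state arises from two orthogonal logical states, and
no recovery can return both. If they are disjoint, measuring the translate and undoing the shift is
a recovery. Correctable supports are therefore the independent sets of the Cayley graph. Since E_t -
E_t = E_{2t}, those for E_t are the codes of distance at least 2t + 1. The clauses for general n
follow from this and from counting words by weight.

The numerical values need separate arguments. For A₂(8,3) ≤ 20, sums of squares of characters of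
parity-extended words leave only size 21 open, and there oddness makes every character sum nonzero
(`card_le_twenty`). For A₂(16,6) ≤ 256 there is a Delsarte certificate (`delsarte_bound`). Linear
codes with these parameters have at most 128 words by sphere packing in a residual code
(`card_mul_le_of_minimal_weight`). Explicit codes attain these bounds, the nonlinear one of length
16 being the Nordstrom–Robinson code. On the ring, ten independent vertices are excluded by an
exhaustive search, reduced by translation and rotation and pruned by clique covers
(`boundIndep_sound`). -/

/-! ### The Fourier basis -/

theorem stdAddChar_two_star (a : ZMod 2) :
    (starRingEnd ℂ) (ZMod.stdAddChar a) = ZMod.stdAddChar a := by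
  rw [← AddChar.map_neg_eq_conj, ZMod.neg_eq_self_mod_two]

/-- Characters multiply when their labels add; this turns phase noise into translation of supports.
-/
theorem phaseOp_fourierVec {n : ℕ} (ω s : V n) :
    phaseOp ω (fourierVec s) = fourierVec (ω + s) := by
  unfold phaseOp fourierVec
  rw [Matrix.toEuclideanCLM_toLp]
  congr 1
  ext x
  rw [Matrix.mulVec_diagonal, add_dotProduct, AddChar.map_add_eq_mul]
  ring

theorem sum_stdAddChar_dotProduct {n : ℕ} (s : V n) :
    ∑ x : V n, (ZMod.stdAddChar (s ⬝ᵥ x) : ℂ) = if s = 0 then 2 ^ n else 0 := by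
  split_ifs with h
  · simp [h, Fintype.card_pi, ZMod.card]
  · let ψ : AddChar (V n) ℂ :=
      { toFun := fun x => ZMod.stdAddChar (s ⬝ᵥ x)
        map_zero_eq_one' := by simp
        map_add_eq_mul' := fun x y => by rw [dotProduct_add, AddChar.map_add_eq_mul] }
    refine (AddChar.sum_eq_zero_iff_ne_zero (ψ := ψ)).2 fun hψ => h ?_
    funext i
    have h1 : ψ (Pi.single i 1) = 1 := by rw [hψ]; rfl
    have h2 : (ZMod.stdAddChar (s ⬝ᵥ Pi.single i 1) : ℂ) = ZMod.stdAddChar (0 : ZMod 2) := by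
      rw [AddChar.map_zero_eq_one]; exact h1
    simpa using ZMod.injective_stdAddChar h2

theorem orthonormal_fourierVec (n : ℕ) : Orthonormal ℂ (fourierVec : V n → Hilb n) := by
  classical
  rw [orthonormal_iff_ite]
  intro s s'
  simp only [fourierVec, PiLp.inner_apply, RCLike.inner_apply, map_mul, Complex.conj_ofReal,
    stdAddChar_two_star]
  have h2 : (((1 / Real.sqrt (2 ^ n) : ℝ) : ℂ)) * ((1 / Real.sqrt (2 ^ n) : ℝ) : ℂ) * 2 ^ n = 1 := by
    rw [← Complex.ofReal_mul, div_mul_div_comm, Real.mul_self_sqrt (by positivity)]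
    push_cast
    field_simp
  have : ∀ x : V n, ((1 / Real.sqrt (2 ^ n) : ℝ) : ℂ) * ZMod.stdAddChar (s' ⬝ᵥ x) *
      (((1 / Real.sqrt (2 ^ n) : ℝ) : ℂ) * ZMod.stdAddChar (s ⬝ᵥ x)) =
      (((1 / Real.sqrt (2 ^ n) : ℝ) : ℂ)) * ((1 / Real.sqrt (2 ^ n) : ℝ) : ℂ) *
        ZMod.stdAddChar ((s + s') ⬝ᵥ x) := by
    intro x
    rw [add_dotProduct, AddChar.map_add_eq_mul]
    ring
  simp_rw [this]
  rw [← Finset.mul_sum, sum_stdAddChar_dotProduct]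
  have h0 : s + s' = 0 ↔ s = s' := by
    rw [add_eq_zero_iff_eq_neg, ZModModule.neg_eq_self]
  simp only [h0]
  split_ifs
  · exact h2
  · simp

/-- The Fourier basis of `ℂ^V`. -/
noncomputable def phaseBasis (n : ℕ) : OrthonormalBasis (V n) ℂ (Hilb n) :=
  OrthonormalBasis.mk (orthonormal_fourierVec n) (by
    rw [(orthonormal_fourierVec n).linearIndependent.span_eq_top_of_card_eq_finrank' (by simp)])

theorem phaseBasis_apply {n : ℕ} (s : V n) : phaseBasis n s = fourierVec s := by
  simp [phaseBasis]

theorem logicalDim_eq_ncard {n : ℕ} (S : Set (V n)) : logicalDim S = S.ncard := by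
  classical
  have h := (orthonormal_fourierVec n).linearIndependent
  have : (fourierVec '' S : Set (Hilb n)) = Set.range (fun s : S => fourierVec (s : V n)) := by
    ext; simp
  rw [logicalDim, fourierCode, this,
    finrank_span_eq_card (b := fun s : S => (fourierVec (s : V n) : Hilb n))
      (h.comp (fun s : S => (s : V n)) Subtype.val_injective),
    ← Nat.card_eq_fintype_card, Nat.card_coe_set_eq]

/-! ### Correctability as disjointness of translates -/

/-- No two distinct elements of `S` differ by a difference of two errors in `Ω`. -/
def DifferenceFree {n : ℕ} (S Ω : Set (V n)) : Prop :=
  ∀ s ∈ S, ∀ s' ∈ S, s ≠ s' → s - s' ∉ Ω - Ω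

section Kraus

variable {H : Type*} [NormedAddCommGroup H] [InnerProductSpace ℂ H] [CompleteSpace H]

theorem krausMap_rankOne {m : ℕ} (R : Fin m → H →L[ℂ] H) (φ : H) :
    krausMap R (InnerProductSpace.rankOne ℂ φ φ) =
      ∑ k, InnerProductSpace.rankOne ℂ (R k φ) (R k φ) := by
  unfold krausMap
  refine Finset.sum_congr rfl fun k _ => ?_
  rw [InnerProductSpace.rankOne_comp, ContinuousLinearMap.adjoint_adjoint,
    InnerProductSpace.comp_rankOne]

theorem comp_rankOne_comp_adjoint (E : H →L[ℂ] H) (ψ : H) :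
    E ∘L InnerProductSpace.rankOne ℂ ψ ψ ∘L E.adjoint =
      InnerProductSpace.rankOne ℂ (E ψ) (E ψ) := by
  rw [InnerProductSpace.rankOne_comp, ContinuousLinearMap.adjoint_adjoint,
    InnerProductSpace.comp_rankOne]

/-- The output is a sum of positive rank-one operators, so it vanishes only if every Kraus operator
kills φ, which trace preservation forbids. -/
theorem krausMap_rankOne_ne_zero {m : ℕ} {R : Fin m → H →L[ℂ] H}
    (hR : ∑ k, (R k).adjoint ∘L R k = ContinuousLinearMap.id ℂ H) {φ : H} (hφ : φ ≠ 0) :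
    krausMap R (InnerProductSpace.rankOne ℂ φ φ) ≠ 0 := by
  intro h
  rw [krausMap_rankOne] at h
  have hz : ∀ k, R k φ = 0 := by
    intro k
    -- Tested on `R k φ`, the sum has nonnegative terms, and its k-th term is the fourth power of
    -- the norm of `R k φ`.
    have h1 := congrArg (fun T : H →L[ℂ] H => RCLike.re (inner ℂ (R k φ) (T (R k φ)))) h
    simp only [sum_apply, inner_sum, InnerProductSpace.rankOne_apply,
      inner_smul_right, zero_apply, inner_zero_right, map_sum, map_zero] at h1
    have h2 : ∀ j, 0 ≤ RCLike.re (inner ℂ (R j φ) (R k φ) * inner ℂ (R k φ) (R j φ)) := by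
      intro j
      rw [← inner_conj_symm (R j φ) (R k φ), RCLike.conj_mul]
      norm_cast
      positivity
    have h3 := (Finset.sum_eq_zero_iff_of_nonneg fun j _ => h2 j).1 h1 k (Finset.mem_univ k)
    rw [inner_self_eq_norm_sq_to_K] at h3
    norm_cast at h3
    simpa using h3
  have h4 := congrArg (fun T : H →L[ℂ] H => T φ) hR
  simp [hz] at h4
  exact hφ h4.symm

end Kraus

theorem fourierVec_mem_fourierCode {n : ℕ} {S : Set (V n)} {s : V n} (hs : s ∈ S) :
    fourierVec s ∈ fourierCode S :=
  Submodule.subset_span ⟨s, hs, rfl⟩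

theorem fourierVec_ne_zero {n : ℕ} (s : V n) : (fourierVec s : Hilb n) ≠ 0 :=
  (orthonormal_fourierVec n).ne_zero s

/-- A forbidden difference gives ω' + s = ω + s', so the recovery receives the same state from s and
from s'. Its output would be a multiple of two orthogonal projections, hence zero. -/
theorem differenceFree_of_correctsPhase {n : ℕ} {S Ω : Set (V n)} (h : CorrectsPhase S Ω) :
    DifferenceFree S Ω := by
  rintro s hs s' hs' hne ⟨ω, hω, ω', hω', hd⟩
  obtain ⟨m, R, hR, hcorr⟩ := h
  obtain ⟨c, hc⟩ := hcorr _ ⟨ω', hω', rfl⟩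
  obtain ⟨c', hc'⟩ := hcorr _ ⟨ω, hω, rfl⟩
  have h1 := hc _ (fourierVec_mem_fourierCode hs)
  have h2 := hc' _ (fourierVec_mem_fourierCode hs')
  simp only at hd
  have he : ω' + s = ω + s' := by
    rw [add_comm ω' s, ← sub_eq_sub_iff_add_eq_add]; exact hd.symm
  rw [comp_rankOne_comp_adjoint, phaseOp_fourierVec] at h1 h2
  rw [he] at h1
  -- Evaluation at the vector of s kills the projection on s' and forces c = 0.
  have h3 := congrArg (fun T : Hilb n →L[ℂ] Hilb n => T (fourierVec s)) (h1.symm.trans h2)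
  have h4 : inner ℂ (fourierVec s' : Hilb n) (fourierVec s) = 0 :=
    (orthonormal_fourierVec n).2 hne.symm
  have h5 : inner ℂ (fourierVec s : Hilb n) (fourierVec s) = 1 :=
    inner_self_eq_one_of_norm_eq_one ((orthonormal_fourierVec n).1 s)
  simp only [smul_apply, InnerProductSpace.rankOne_apply, h4, h5, one_smul,
    zero_smul, smul_zero, smul_eq_zero, fourierVec_ne_zero, or_false] at h3
  rw [h3, zero_smul] at h1
  exact krausMap_rankOne_ne_zero hR (fourierVec_ne_zero _) h1

open scoped Classical in
/-- The Kraus operators of the recovery: `some ω` with `ω ∈ Ω` projects on `Z^ω C(S)` and undoes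
`Z^ω`, while `none` projects on the orthogonal complement of all the `Z^ω C(S)`. -/
noncomputable def recoveryOp {n : ℕ} (S Ω : Set (V n)) (k : Option (V n)) : Hilb n →L[ℂ] Hilb n :=
  LinearMap.toContinuousLinearMap ((phaseBasis n).toBasis.constr ℂ fun v =>
    match k with
    | some ω => if ω ∈ Ω ∧ ω + v ∈ S then fourierVec (ω + v) else 0
    | none => if ∃ ω ∈ Ω, ω + v ∈ S then 0 else fourierVec v)

open scoped Classical in
theorem recoveryOp_some {n : ℕ} (S Ω : Set (V n)) (ω v : V n) :
    recoveryOp S Ω (some ω) (fourierVec v) =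
      if ω ∈ Ω ∧ ω + v ∈ S then fourierVec (ω + v) else 0 := by
  have := (phaseBasis n).toBasis.constr_basis ℂ
    (fun v => if ω ∈ Ω ∧ ω + v ∈ S then fourierVec (ω + v) else (0 : Hilb n)) v
  rw [OrthonormalBasis.coe_toBasis, phaseBasis_apply] at this
  exact this

open scoped Classical in
theorem recoveryOp_none {n : ℕ} (S Ω : Set (V n)) (v : V n) :
    recoveryOp S Ω none (fourierVec v) =
      if ∃ ω ∈ Ω, ω + v ∈ S then 0 else fourierVec v := by
  have := (phaseBasis n).toBasis.constr_basis ℂ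
    (fun v => if ∃ ω ∈ Ω, ω + v ∈ S then (0 : Hilb n) else fourierVec v) v
  rw [OrthonormalBasis.coe_toBasis, phaseBasis_apply] at this
  exact this

/-- In characteristic two ω + v ∈ S says v ∈ ω + S, so this is the disjointness of the translates.
-/
theorem DifferenceFree.eq_of_add_mem {n : ℕ} {S Ω : Set (V n)} (h : DifferenceFree S Ω)
    {ω ω' v : V n} (hω : ω ∈ Ω) (hω' : ω' ∈ Ω) (hv : ω + v ∈ S) (hv' : ω' + v ∈ S) : ω = ω' := by
  by_contra hne
  refine h _ hv _ hv' (fun h => hne (add_right_cancel h)) ?_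
  rw [add_sub_add_right_eq_sub]
  exact Set.sub_mem_sub hω hω'

/-- Each Fourier vector survives under exactly one Kraus operator. Each operator shifts the labels
it keeps injectively, so off-diagonal entries vanish. -/
theorem sum_adjoint_recoveryOp {n : ℕ} {S Ω : Set (V n)} (h : DifferenceFree S Ω) :
    ∑ k, (recoveryOp S Ω k).adjoint ∘L recoveryOp S Ω k = ContinuousLinearMap.id ℂ (Hilb n) := by
  classical
  apply ContinuousLinearMap.coe_injective
  refine (phaseBasis n).toBasis.ext fun v => ?_
  refine InnerProductSpace.ext_inner_left_basis (phaseBasis n).toBasis fun w => ?_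
  have hin : ∀ a b : V n, inner ℂ (fourierVec a : Hilb n) (fourierVec b) = if a = b then 1 else 0 :=
    orthonormal_iff_ite.1 (orthonormal_fourierVec n)
  simp only [OrthonormalBasis.coe_toBasis, phaseBasis_apply, ContinuousLinearMap.coe_coe,
    sum_apply, add_apply, inner_add_right, ContinuousLinearMap.comp_apply, inner_sum,
    ContinuousLinearMap.adjoint_inner_right, ContinuousLinearMap.id_apply, Fintype.sum_option,
    recoveryOp_some, recoveryOp_none]
  by_cases hwv : w = v
  · subst hwv
    by_cases hex : ∃ ω ∈ Ω, ω + w ∈ S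
    · obtain ⟨ω, hω, hs⟩ := hex
      rw [if_pos ⟨ω, hω, hs⟩, Finset.sum_eq_single ω]
      · simp [hω, hs, (orthonormal_fourierVec n).1]
      · intro ω' _ hne
        rw [if_neg fun h' => hne (h.eq_of_add_mem h'.1 hω h'.2 hs), inner_zero_left]
      · simp
    · rw [if_neg hex, Finset.sum_eq_zero]
      · simp
      · intro ω _
        rw [if_neg fun h' => hex ⟨ω, h'⟩, inner_zero_left]
  · rw [hin, if_neg hwv, Finset.sum_eq_zero]
    · split_ifs <;> simp [hin, hwv]
    · intro ω _
      split_ifs <;> simp [hin, hwv]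

theorem recoveryOp_phaseOp {n : ℕ} {S Ω : Set (V n)} (h : DifferenceFree S Ω) {ω : V n}
    (hω : ω ∈ Ω) {ψ : Hilb n} (hψ : ψ ∈ fourierCode S) (k : Option (V n)) :
    recoveryOp S Ω k (phaseOp ω ψ) = if k = some ω then ψ else 0 := by
  classical
  induction hψ using Submodule.span_induction with
  | zero => simp
  | add x y _ _ hx hy => rw [map_add, map_add, hx, hy]; split_ifs <;> simp
  | smul a x _ hx => rw [map_smul, map_smul, hx]; split_ifs <;> simp
  | mem x hx =>
    obtain ⟨s, hs, rfl⟩ := hx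
    have hself : ω + (ω + s) = s := by rw [← add_assoc, ZModModule.add_self, zero_add]
    rw [phaseOp_fourierVec]
    cases k with
    | none =>
      rw [recoveryOp_none, if_pos ⟨ω, hω, by rwa [hself]⟩]
      simp
    | some ω' =>
      rw [recoveryOp_some]
      by_cases hk : ω' = ω
      · subst hk
        simp [hself, hω, hs]
      · rw [if_neg, if_neg (by simpa using hk)]
        rintro ⟨h1, h2⟩
        exact hk (h.eq_of_add_mem h1 hω h2 (by rwa [hself]))

theorem DifferenceFree.correctsPhase {n : ℕ} {S Ω : Set (V n)} (h : DifferenceFree S Ω) :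
    CorrectsPhase S Ω := by
  classical
  let e := Fintype.equivFin (Option (V n))
  refine ⟨_, fun k => recoveryOp S Ω (e.symm k), ?_, ?_⟩
  · rw [← sum_adjoint_recoveryOp h]
    exact Equiv.sum_comp e.symm (fun k => (recoveryOp S Ω k).adjoint ∘L recoveryOp S Ω k)
  · rintro _ ⟨ω, hω, rfl⟩
    refine ⟨1, fun ψ hψ => ?_⟩
    rw [comp_rankOne_comp_adjoint, krausMap_rankOne, one_smul,
      Finset.sum_eq_single (e (some ω))]
    · rw [recoveryOp_phaseOp h hω hψ, if_pos (by simp)]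
    · intro k _ hk
      rw [recoveryOp_phaseOp h hω hψ, if_neg]
      · simp
      · rintro hk'
        exact hk (by rw [← hk', Equiv.apply_symm_apply])
    · simp

theorem correctsPhase_iff {n : ℕ} {S Ω : Set (V n)} : CorrectsPhase S Ω ↔ DifferenceFree S Ω :=
  ⟨differenceFree_of_correctsPhase, DifferenceFree.correctsPhase⟩

/-! ### Hamming balls, minimum distance and extremal code sizes -/

theorem natCast_le_minDist_iff {n d : ℕ} {S : Set (V n)} :
    (d : ℕ∞) ≤ minDist S ↔ ∀ x ∈ S, ∀ y ∈ S, x ≠ y → d ≤ hammingDist x y := by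
  simp [minDist]

theorem mem_weightBall {n t : ℕ} {ω : V n} : ω ∈ weightBall n t ↔ hammingNorm ω ≤ t := Iff.rfl

theorem hammingNorm_sub {n : ℕ} (x y : V n) : hammingNorm (x - y) = hammingDist x y := by
  rw [hammingDist_comm, hammingDist_eq_hammingNorm, neg_add_eq_sub]

theorem hammingNorm_sub_le {n : ℕ} (x y : V n) :
    hammingNorm (x - y) ≤ hammingNorm x + hammingNorm y := by
  simpa [hammingNorm_sub] using hammingDist_triangle x 0 y

/-- A word of weight at most `2t` splits into two words of weight at most `t`. -/
theorem exists_eq_sub_of_hammingNorm_le {n t : ℕ} {z : V n} (hz : hammingNorm z ≤ 2 * t) :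
    ∃ x y : V n, hammingNorm x ≤ t ∧ hammingNorm y ≤ t ∧ x - y = z := by
  classical
  let A : Finset (Fin n) := {i | z i ≠ 0}
  have hA : A.card = hammingNorm z := rfl
  -- `B` is half of the support, rounded down; the other half has at most t elements because the
  -- weight is at most 2t.
  obtain ⟨B, hBA, hB⟩ := Finset.exists_subset_card_eq (Nat.div_le_self A.card 2)
  refine ⟨fun i => if i ∈ B then z i else 0, fun i => if i ∈ B then 0 else -z i, ?_, ?_, ?_⟩
  · have : hammingNorm (fun i => if i ∈ B then z i else 0) ≤ B.card :=
      Finset.card_le_card fun i hi => by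
        by_contra h
        simp [h] at hi
    omega
  · have : hammingNorm (fun i => if i ∈ B then 0 else -z i) ≤ (A \ B).card :=
      Finset.card_le_card fun i hi => by
        simp at hi
        simp [A, hi]
    rw [Finset.card_sdiff_of_subset hBA] at this
    omega
  · funext i
    by_cases h : i ∈ B <;> simp [h]

theorem weightBall_sub_weightBall (n t : ℕ) :
    weightBall n t - weightBall n t = weightBall n (2 * t) := by
  ext z
  constructor
  · rintro ⟨x, hx, y, hy, rfl⟩
    have := hammingNorm_sub_le x y
    simp only [mem_weightBall] at *
    omega
  · intro hz
    obtain ⟨x, y, hx, hy, rfl⟩ := exists_eq_sub_of_hammingNorm_le hz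
    exact Set.sub_mem_sub hx hy

theorem correctsPhase_weightBall_iff (n t : ℕ) (S : Set (V n)) :
    CorrectsPhase S (weightBall n t) ↔ ((2 * t + 1 : ℕ) : ℕ∞) ≤ minDist S := by
  rw [correctsPhase_iff, natCast_le_minDist_iff, DifferenceFree, weightBall_sub_weightBall]
  refine forall₅_congr fun x _ y _ _ => ?_
  rw [mem_weightBall, hammingNorm_sub]
  omega

theorem correctsPhase_weightBall_iff_inter (n t : ℕ) (S : Set (V n)) (hS : S.Nonempty) :
    CorrectsPhase S (weightBall n t) ↔ (S - S) ∩ weightBall n (2 * t) = {0} := by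
  rw [correctsPhase_iff, DifferenceFree, weightBall_sub_weightBall]
  constructor
  · intro h
    ext z
    constructor
    · rintro ⟨⟨x, hx, y, hy, rfl⟩, hz⟩
      by_contra hne
      exact h x hx y hy (fun hxy => hne (by simp [hxy])) hz
    · rintro rfl
      obtain ⟨s, hs⟩ := hS
      exact ⟨⟨s, hs, s, hs, sub_self s⟩, by simp [mem_weightBall]⟩
  · intro h x hx y hy hne hmem
    have : x - y ∈ (S - S) ∩ weightBall n (2 * t) := ⟨Set.sub_mem_sub hx hy, hmem⟩
    rw [h] at this
    exact hne (sub_eq_zero.1 this)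

theorem ncard_le_two_pow {n : ℕ} (S : Set (V n)) : S.ncard ≤ 2 ^ n := by
  have := Set.ncard_le_card S
  simpa [Fintype.card_pi, ZMod.card] using this

theorem maxLogicalDim_weightBall (n t : ℕ) :
    maxLogicalDim (weightBall n t) = maxCodeSize n (2 * t + 1) := by
  simp only [maxLogicalDim, maxCodeSize, correctsPhase_weightBall_iff, logicalDim_eq_ncard]

theorem bddAbove_codeSizes (n d : ℕ) :
    BddAbove {K | ∃ S : Set (V n), (d : ℕ∞) ≤ minDist S ∧ S.ncard = K} :=
  ⟨2 ^ n, by rintro _ ⟨S, -, rfl⟩; exact ncard_le_two_pow S⟩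

theorem bddAbove_linearCodeSizes (n d : ℕ) :
    BddAbove {K | ∃ U : Submodule (ZMod 2) (V n),
      (d : ℕ∞) ≤ minDist (U : Set (V n)) ∧ (U : Set (V n)).ncard = K} :=
  ⟨2 ^ n, by rintro _ ⟨S, -, rfl⟩; exact ncard_le_two_pow _⟩

theorem ncard_le_maxCodeSize {n d : ℕ} {S : Set (V n)} (hS : (d : ℕ∞) ≤ minDist S) :
    S.ncard ≤ maxCodeSize n d :=
  le_csSup (bddAbove_codeSizes n d) ⟨S, hS, rfl⟩

theorem ncard_le_maxLinearCodeSize {n d : ℕ} {U : Submodule (ZMod 2) (V n)}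
    (hU : (d : ℕ∞) ≤ minDist (U : Set (V n))) :
    (U : Set (V n)).ncard ≤ maxLinearCodeSize n d :=
  le_csSup (bddAbove_linearCodeSizes n d) ⟨U, hU, rfl⟩

theorem exists_ncard_eq_maxCodeSize (n d : ℕ) :
    ∃ S : Set (V n), (d : ℕ∞) ≤ minDist S ∧ S.ncard = maxCodeSize n d :=
  Nat.sSup_mem (s := {K | ∃ S : Set (V n), (d : ℕ∞) ≤ minDist S ∧ S.ncard = K})
    ⟨0, ∅, by simp [minDist], by simp⟩ (bddAbove_codeSizes n d)

theorem exists_ncard_eq_maxLinearCodeSize (n d : ℕ) :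
    ∃ U : Submodule (ZMod 2) (V n), (d : ℕ∞) ≤ minDist (U : Set (V n)) ∧
      (U : Set (V n)).ncard = maxLinearCodeSize n d :=
  Nat.sSup_mem (s := {K | ∃ U : Submodule (ZMod 2) (V n),
      (d : ℕ∞) ≤ minDist (U : Set (V n)) ∧ (U : Set (V n)).ncard = K})
    ⟨1, ⊥, by simp [minDist], by simp⟩ (bddAbove_linearCodeSizes n d)

theorem ncard_le_maxLinearCodeSize_of_isAffineSupport {n d : ℕ} {S : Set (V n)}
    (hS : IsAffineSupport S) (hd : (d : ℕ∞) ≤ minDist S) : S.ncard ≤ maxLinearCodeSize n d := by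
  obtain ⟨v, U, rfl⟩ := hS
  rw [Set.ncard_image_of_injective _ (add_right_injective v)]
  refine ncard_le_maxLinearCodeSize ?_
  rw [natCast_le_minDist_iff] at hd ⊢
  intro x hx y hy hne
  have := hd _ ⟨x, hx, rfl⟩ _ ⟨y, hy, rfl⟩ (fun h => hne (add_left_cancel h))
  simpa [← hammingNorm_sub] using this

theorem exists_nonaffine_of_maxLinearCodeSize_lt {n t : ℕ}
    (h : maxLinearCodeSize n (2 * t + 1) < maxCodeSize n (2 * t + 1)) :
    ∃ S : Set (V n), CorrectsPhase S (weightBall n t) ∧ ¬ IsAffineSupport S ∧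
      ∀ S' : Set (V n), IsAffineSupport S' → CorrectsPhase S' (weightBall n t) →
        logicalDim S' < logicalDim S := by
  obtain ⟨S, hS, hc⟩ := exists_ncard_eq_maxCodeSize n (2 * t + 1)
  simp only [correctsPhase_weightBall_iff, logicalDim_eq_ncard]
  refine ⟨S, hS, fun ha => ?_, fun S' ha hS' => ?_⟩
  · have := ncard_le_maxLinearCodeSize_of_isAffineSupport ha hS
    omega
  · have := ncard_le_maxLinearCodeSize_of_isAffineSupport ha hS'
    omega

/-! ### Independent sets of the noise graph -/

theorem noiseGraph_adj {n : ℕ} {Ω : Set (V n)} {x y : V n} :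
    (noiseGraph Ω).Adj x y ↔ x ≠ y ∧ x - y ∈ Ω - Ω := by
  have hsymm : ∀ z : V n, -z = z := fun z => ZModModule.neg_eq_self z
  rw [noiseGraph, SimpleGraph.addCayley_adj']
  refine and_congr_right fun hne => ?_
  constructor
  · rintro ⟨g, ⟨hg, -⟩, rfl | rfl⟩
    · rwa [sub_add_cancel_left, hsymm]
    · rwa [add_sub_cancel_left]
  · intro h
    exact ⟨x - y, ⟨h, sub_ne_zero.2 hne⟩, Or.inr (add_sub_cancel y x).symm⟩

theorem differenceFree_iff_isIndepSet {n : ℕ} {S Ω : Set (V n)} :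
    DifferenceFree S Ω ↔ (noiseGraph Ω).IsIndepSet S := by
  rw [SimpleGraph.isIndepSet_iff]
  refine forall₅_congr fun x _ y _ hne => ?_
  simp [noiseGraph_adj, hne]

theorem maxLogicalDim_eq_indepNum {n : ℕ} (Ω : Set (V n)) :
    maxLogicalDim Ω = (noiseGraph Ω).indepNum := by
  classical
  unfold maxLogicalDim SimpleGraph.indepNum
  congr 1
  ext K
  simp only [Set.mem_ofPred_eq, correctsPhase_iff, differenceFree_iff_isIndepSet,
    logicalDim_eq_ncard, SimpleGraph.isNIndepSet_iff]
  constructor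
  · rintro ⟨S, hS, rfl⟩
    exact ⟨S.toFinset, by simpa using hS, (Set.ncard_eq_toFinset_card' S).symm⟩
  · rintro ⟨s, hs, rfl⟩
    exact ⟨s, hs, Set.ncard_coe_finset s⟩

/-! ### Threshold probabilities -/

theorem errorProb_eq {n : ℕ} (p : ℝ) (ω : V n) :
    errorProb p ω = p ^ hammingNorm ω * (1 - p) ^ (n - hammingNorm ω) := by
  classical
  have h := Finset.card_filter_add_card_filter_not (s := (Finset.univ : Finset (Fin n))) (fun i => ω i = 0)
  rw [errorProb, Finset.prod_ite, Finset.prod_const, Finset.prod_const, mul_comm]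
  have h' : hammingNorm ω = (Finset.univ.filter fun i => ¬ ω i = 0).card := rfl
  rw [Finset.card_univ, Fintype.card_fin] at h
  rw [← h']
  congr 2
  omega

theorem card_hammingNorm_eq (n j : ℕ) :
    (Finset.univ.filter fun ω : V n => hammingNorm ω = j).card = n.choose j := by
  classical
  have h := Finset.card_powersetCard j (Finset.univ : Finset (Fin n))
  rw [Finset.card_univ, Fintype.card_fin] at h
  rw [← h]
  refine Finset.card_nbij' (fun ω => Finset.univ.filter fun i => ω i ≠ 0)
    (fun A i => if i ∈ A then 1 else 0) ?_ ?_ ?_ ?_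
  · intro ω hω
    simp only [Finset.coe_filter, Finset.mem_univ, true_and, Set.mem_ofPred_eq] at hω
    simpa [hammingNorm] using hω
  · intro A hA
    simp only [Finset.coe_filter, Finset.mem_univ, true_and, Set.mem_ofPred_eq]
    simp at hA
    simpa [hammingNorm] using hA
  · intro ω _
    funext i
    have : ∀ a : ZMod 2, (if a ≠ 0 then (1 : ZMod 2) else 0) = a := by decide
    simpa using this (ω i)
  · intro A _
    ext i
    simp

theorem thresholdProb_eq_corrProb {n : ℕ} (S : Set (V n)) (p : ℝ) :
    thresholdProb S p = corrProb n (correctionRadius S) p := by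
  classical
  unfold thresholdProb corrProb
  generalize correctionRadius S = r
  have hmap : ∀ ω ∈ (Finset.univ.filter fun ω : V n => ω ∈ weightBall n r),
      hammingNorm ω ∈ Finset.range (r + 1) := by
    intro ω hω
    simp [mem_weightBall] at hω
    simp only [Finset.mem_range]
    omega
  rw [← Finset.sum_fiberwise_of_maps_to hmap]
  refine Finset.sum_congr rfl fun j hj => ?_
  have hf : ((Finset.univ.filter fun ω : V n => ω ∈ weightBall n r).filter
      fun ω => hammingNorm ω = j) = Finset.univ.filter fun ω : V n => hammingNorm ω = j := by
    ext ω
    simp only [Finset.mem_filter, Finset.mem_univ, true_and, mem_weightBall, Finset.mem_range] at *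
    omega
  rw [hf, Finset.sum_congr rfl fun ω hω => by
    rw [errorProb_eq, (Finset.mem_filter.1 hω).2], Finset.sum_const, card_hammingNorm_eq,
    nsmul_eq_mul, mul_assoc]

theorem correctionRadius_congr {n : ℕ} {S S' : Set (V n)}
    (h : ∀ t : ℕ, ((2 * t + 1 : ℕ) : ℕ∞) ≤ minDist S ↔ ((2 * t + 1 : ℕ) : ℕ∞) ≤ minDist S') :
    correctionRadius S = correctionRadius S' := by
  simp only [correctionRadius, correctsPhase_weightBall_iff, h]

/-! ### Character sums and the bound A₂(8,3) ≤ 20 -/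

/-- The sign `(-1)^a` of a bit. -/
def bitSign (a : ZMod 2) : ℤ := if a = 0 then 1 else -1

theorem bitSign_sub (a b : ZMod 2) : bitSign (a - b) = bitSign a * bitSign b := by
  revert a b; decide

theorem bitSign_mul_self (a : ZMod 2) : bitSign a * bitSign a = 1 := by
  revert a; decide

theorem sum_bitSign {n : ℕ} (z : V n) : ∑ i, bitSign (z i) = n - 2 * hammingNorm z := by
  have h : ∀ i, bitSign (z i) = 1 - 2 * (if z i ≠ 0 then 1 else 0) := fun i => by
    unfold bitSign; split_ifs <;> simp_all
  simp only [h, Finset.sum_sub_distrib, ← Finset.mul_sum, Finset.sum_boole]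
  simp [hammingNorm]

theorem prod_bitSign {n : ℕ} (z : V n) : ∏ i, bitSign (z i) = (-1) ^ hammingNorm z := by
  simp only [bitSign]
  rw [Finset.prod_ite]
  simp [hammingNorm]

/-- For functions `χ i` that turn differences into products, the sum of their values over all
differences of elements of `S` is a sum of squares. -/
theorem sum_sum_sum_sub_eq_sum_sq {n : ℕ} {ι : Type*} (A : Finset ι) (χ : ι → V n → ℤ)
    (hχ : ∀ i x y, χ i (x - y) = χ i x * χ i y) (S : Finset (V n)) :
    ∑ x ∈ S, ∑ y ∈ S, ∑ i ∈ A, χ i (x - y) = ∑ i ∈ A, (∑ x ∈ S, χ i x) ^ 2 := by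
  simp_rw [hχ, sq, Finset.sum_mul_sum]
  rw [Finset.sum_comm (s := A)]
  exact Finset.sum_congr rfl fun x _ => Finset.sum_comm

/-- The eight coordinate signs of a word of length eight, and the sign of its parity. -/
def extendedSign (z : V 8) : Option (Fin 8) → ℤ
  | some i => bitSign (z i)
  | none => ∏ i, bitSign (z i)

theorem extendedSign_sub (x y : V 8) (o : Option (Fin 8)) :
    extendedSign (x - y) o = extendedSign x o * extendedSign y o := by
  cases o <;> simp [extendedSign, bitSign_sub, Finset.prod_mul_distrib]

theorem extendedSign_mul_self (x : V 8) (o : Option (Fin 8)) :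
    extendedSign x o * extendedSign x o = 1 := by
  cases o <;> simp [extendedSign, ← Finset.prod_mul_distrib, bitSign_mul_self]

theorem odd_extendedSign (x : V 8) (o : Option (Fin 8)) : Odd (extendedSign x o) := by
  have h : Odd (extendedSign x o * extendedSign x o) := by
    rw [extendedSign_mul_self]; exact odd_one
  exact (Int.odd_mul.1 h).1

theorem one_le_sq_of_odd {a : ℤ} (h : Odd a) : 1 ≤ a ^ 2 := by
  have : a ≠ 0 := by rintro rfl; exact absurd h (by decide)
  have := sq_pos_of_ne_zero this
  omega

theorem odd_sum_of_odd_card {ι : Type*} {S : Finset ι} (hS : Odd S.card) {f : ι → ℤ}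
    (hf : ∀ x, Odd (f x)) : Odd (∑ x ∈ S, f x) := by
  have h : ∑ x ∈ S, f x = ∑ x ∈ S, (f x - 1) + S.card := by simp [Finset.sum_sub_distrib]
  rw [h]
  exact (Finset.even_sum _ fun x _ => (hf x).sub_odd odd_one).add_odd (by exact_mod_cast hS)

theorem sum_extendedSign (z : V 8) :
    ∑ o, extendedSign z o = (-1) ^ hammingNorm z + (8 - 2 * hammingNorm z) := by
  rw [Fintype.sum_option]
  simp only [extendedSign, sum_bitSign, prod_bitSign]
  norm_num

/-- A sum of an odd number of signs is odd, so its square is at least 1. The linear part has 9 such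
squares. The quadratic part has 81, of which the 9 diagonal ones equal |S|² since signs square to
one. The excess is 2·9 + 72 = 90. -/
theorem le_sum_sum_of_odd_card {S : Finset (V 8)} (hS : Odd S.card) :
    (9 * S.card ^ 2 + 90 : ℤ) ≤ ∑ x ∈ S, ∑ y ∈ S,
      (2 * ∑ o, extendedSign (x - y) o + (∑ o, extendedSign (x - y) o) ^ 2) := by
  have h1 : (9 : ℤ) ≤ ∑ x ∈ S, ∑ y ∈ S, ∑ o, extendedSign (x - y) o := by
    rw [sum_sum_sum_sub_eq_sum_sq _ (fun o z => extendedSign z o)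
      (fun o x y => extendedSign_sub x y o)]
    have h := Finset.card_nsmul_le_sum (Finset.univ : Finset (Option (Fin 8)))
      (fun o => (∑ x ∈ S, extendedSign x o) ^ 2) 1
      (fun o _ => one_le_sq_of_odd (odd_sum_of_odd_card hS fun x => odd_extendedSign x o))
    simpa using h
  have h2 : (9 * S.card ^ 2 + 72 : ℤ) ≤
      ∑ x ∈ S, ∑ y ∈ S, (∑ o, extendedSign (x - y) o) ^ 2 := by
    have : ∑ x ∈ S, ∑ y ∈ S, (∑ o, extendedSign (x - y) o) ^ 2 =
        ∑ p : Option (Fin 8) × Option (Fin 8),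
          (∑ x ∈ S, extendedSign x p.1 * extendedSign x p.2) ^ 2 := by
      rw [← sum_sum_sum_sub_eq_sum_sq _
        (fun (p : Option (Fin 8) × Option (Fin 8)) z => extendedSign z p.1 * extendedSign z p.2)
        (fun p x y => by rw [extendedSign_sub, extendedSign_sub]; ring)]
      simp_rw [sq, Finset.sum_mul_sum, Fintype.sum_prod_type]
    rw [this]
    have h : ∀ p : Option (Fin 8) × Option (Fin 8),
        (if p.1 = p.2 then (S.card ^ 2 : ℤ) else 1) ≤
          (∑ x ∈ S, extendedSign x p.1 * extendedSign x p.2) ^ 2 := by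
      rintro ⟨o, o'⟩
      split_ifs with he
      · simp only at he
        subst he
        simp [extendedSign_mul_self]
      · exact one_le_sq_of_odd (odd_sum_of_odd_card hS fun x =>
          (odd_extendedSign x o).mul (odd_extendedSign x o'))
    refine le_trans (le_of_eq ?_) (Finset.sum_le_sum fun p _ => h p)
    rw [Finset.sum_ite, Finset.sum_const, Finset.sum_const]
    have c1 : (Finset.univ.filter fun p : Option (Fin 8) × Option (Fin 8) => p.1 = p.2).card = 9 := by
      decide
    have c2 : (Finset.univ.filter fun p : Option (Fin 8) × Option (Fin 8) => ¬ p.1 = p.2).card = 72 := by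
      decide
    rw [c1, c2]
    simp
  simp only [Finset.sum_add_distrib, ← Finset.mul_sum]
  linarith

/-- Among three bits at most two of the three pairs differ. -/
theorem hammingDist_add_add_le {n : ℕ} (x y z : V n) :
    hammingDist x y + hammingDist x z + hammingDist y z ≤ 2 * n := by
  have h : ∀ a b c : ZMod 2, (if a ≠ b then 1 else 0) + (if a ≠ c then 1 else 0) +
      (if b ≠ c then 1 else 0) ≤ 2 := by decide
  have e : ∀ u v : V n, hammingDist u v = ∑ i, if u i ≠ v i then 1 else 0 := fun u v => by
    rw [hammingDist, Finset.card_filter]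
  rw [e, e, e, ← Finset.sum_add_distrib, ← Finset.sum_add_distrib]
  refine (Finset.sum_le_sum fun i _ => h _ _ _).trans ?_
  simp [mul_comm]

/-- With the parity bit, distinct words have distance 4, 6 or 8, where the character sum s is 1, -3
or -7. The polynomial s² + 2s is 3 at the first two, 35 at the last and 99 at s = 9. Without parity
one only gets 6|S| ≤ 128, which still allows 21; the oddness excess excludes it, as 21·191 = 4011 <
4059 = 9·21² + 90. -/
theorem card_le_twenty {S : Finset (V 8)}
    (hS : ∀ x ∈ S, ∀ y ∈ S, x ≠ y → 3 ≤ hammingDist x y) : S.card ≤ 20 := by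
  classical
  by_contra hlt
  obtain ⟨T, hTS, hT⟩ := Finset.exists_subset_card_eq (show 21 ≤ S.card by omega)
  have hTd : ∀ x ∈ T, ∀ y ∈ T, x ≠ y → 3 ≤ hammingDist x y :=
    fun x hx y hy => hS x (hTS hx) y (hTS hy)
  have hle := le_sum_sum_of_odd_card (S := T) (by rw [hT]; decide)
  have hval : ∀ x ∈ T, ∀ y ∈ T, 2 * ∑ o, extendedSign (x - y) o +
      (∑ o, extendedSign (x - y) o) ^ 2 ≤
        3 + (if x = y then 96 else 0) + (if 7 ≤ hammingDist x y then 32 else 0) := by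
    intro x hx y hy
    rw [sum_extendedSign, hammingNorm_sub]
    by_cases hxy : x = y
    · subst hxy; simp
    · have h3 := hTd x hx y hy hxy
      have h8 : hammingDist x y ≤ 8 := by simpa using hammingDist_le_card_fintype (x := x) (y := y)
      rw [if_neg hxy]
      generalize hammingDist x y = d at h3 h8
      interval_cases d <;> norm_num
  have hrow : ∀ x ∈ T, ∑ y ∈ T, (3 + (if x = y then 96 else 0) +
      (if 7 ≤ hammingDist x y then 32 else 0) : ℤ) ≤ 191 := by
    intro x hx
    -- Two words at distance at least 7 from x are at distance at most 16 - 14 = 2 from each other.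
    have hone : (T.filter fun y => 7 ≤ hammingDist x y).card ≤ 1 := by
      rw [Finset.card_le_one]
      intro y hy z hz
      simp only [Finset.mem_filter] at hy hz
      by_contra hne
      have := hTd y hy.1 z hz.1 hne
      have := hammingDist_add_add_le x y z
      omega
    rw [Finset.sum_add_distrib, Finset.sum_add_distrib, Finset.sum_const, hT, Finset.sum_ite_eq,
      if_pos hx, ← Finset.sum_filter, Finset.sum_const]
    simp only [nsmul_eq_mul]
    have : ((T.filter fun y => 7 ≤ hammingDist x y).card : ℤ) ≤ 1 := by exact_mod_cast hone
    push_cast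
    linarith
  have htot := Finset.sum_le_sum fun x hx =>
    (Finset.sum_le_sum fun y hy => hval x hx y hy).trans (hrow x hx)
  rw [Finset.sum_const, hT] at htot
  rw [hT] at hle
  norm_num at htot hle
  linarith

/-! ### The linear programming bound and A₂(16,6) ≤ 256 -/

/-- The product of the signs of `z` over a set of coordinates. -/
def subsetSign {n : ℕ} (A : Finset (Fin n)) (z : V n) : ℤ := ∏ i ∈ A, bitSign (z i)

theorem subsetSign_sub {n : ℕ} (A : Finset (Fin n)) (x y : V n) :
    subsetSign A (x - y) = subsetSign A x * subsetSign A y := by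
  simp [subsetSign, bitSign_sub, Finset.prod_mul_distrib]

/-- The Krawtchouk number `K_k(w)`: the coefficient of `X^k` in `(1 + X)^(n - w) (1 - X)^w`. -/
def krawtchouk (n k w : ℕ) : ℤ :=
  ∑ p ∈ Finset.HasAntidiagonal.antidiagonal k, ((n - w).choose p.1 : ℤ) * ((-1) ^ p.2 * (w.choose p.2 : ℤ))

open Polynomial in
theorem coeff_one_sub_X_pow (w k : ℕ) :
    ((1 - X : ℤ[X]) ^ w).coeff k = (-1) ^ k * (w.choose k : ℤ) := by
  have h : (1 - X : ℤ[X]) ^ w = ((1 + X : ℤ[X]) ^ w).comp (C (-1) * X) := by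
    simp [sub_eq_add_neg]
  rw [h, comp_C_mul_X_coeff, coeff_one_add_X_pow, mul_comm]

open Polynomial in
-- Both sides are the coefficient of X^k in the product of the factors 1 + ε X over the coordinate
-- signs ε of z.
theorem sum_subsetSign {n : ℕ} (k : ℕ) (z : V n) :
    ∑ A ∈ Finset.powersetCard k Finset.univ, subsetSign A z = krawtchouk n k (hammingNorm z) := by
  classical
  have h1 : (∏ i, (1 + C (bitSign (z i)) * X : ℤ[X])) =
      (1 + X) ^ (n - hammingNorm z) * (1 - X) ^ hammingNorm z := by
    have hc := Finset.card_filter_add_card_filter_not (s := (Finset.univ : Finset (Fin n)))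
      (fun i => z i = 0)
    have hn : hammingNorm z = (Finset.univ.filter fun i => ¬ z i = 0).card := rfl
    rw [Finset.card_univ, Fintype.card_fin, ← hn] at hc
    have hp : ∀ i, (1 + C (bitSign (z i)) * X : ℤ[X]) = if z i = 0 then 1 + X else 1 - X := by
      intro i
      unfold bitSign
      split_ifs <;> simp [sub_eq_add_neg]
    simp only [hp]
    rw [Finset.prod_ite, Finset.prod_const, Finset.prod_const, ← hn]
    congr 2
    omega
  have h2 : (∏ i, (1 + C (bitSign (z i)) * X : ℤ[X])) =
      ∑ A ∈ Finset.univ.powerset, C (subsetSign A z) * X ^ A.card := by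
    rw [Finset.prod_one_add]
    refine Finset.sum_congr rfl fun A _ => ?_
    rw [Finset.prod_mul_distrib, Finset.prod_const, subsetSign, map_prod]
  have h3 := congrArg (fun p : ℤ[X] => p.coeff k) (h2.symm.trans h1)
  simp only [finsetSum_coeff, coeff_C_mul, coeff_X_pow] at h3
  simp only [coeff_mul, coeff_one_add_X_pow, coeff_one_sub_X_pow] at h3
  rw [krawtchouk, ← h3, Finset.powersetCard_eq_filter, Finset.sum_filter]
  refine Finset.sum_congr rfl fun A _ => ?_
  by_cases hA : A.card = k
  · simp [hA]
  · simp [hA, Ne.symm hA]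

/-- Delsarte's linear programming bound: a combination `f` of Krawtchouk polynomials with
nonnegative coefficients `c k` that is nonpositive on the distances of the code bounds its size. -/
theorem delsarte_bound {n d : ℕ} {S : Finset (V n)}
    (hS : ∀ x ∈ S, ∀ y ∈ S, x ≠ y → d ≤ hammingDist x y) (K : Finset ℕ) (c : ℕ → ℤ)
    (hK : 0 ∈ K) (hc : ∀ k ∈ K, 0 ≤ c k)
    (hf : ∀ w, d ≤ w → w ≤ n → ∑ k ∈ K, c k * krawtchouk n k w ≤ 0) :
    c 0 * S.card ^ 2 ≤ S.card * ∑ k ∈ K, c k * krawtchouk n k 0 := by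
  classical
  have hlow : c 0 * S.card ^ 2 ≤
      ∑ x ∈ S, ∑ y ∈ S, ∑ k ∈ K, c k * krawtchouk n k (hammingDist x y) := by
    have he : ∑ x ∈ S, ∑ y ∈ S, ∑ k ∈ K, c k * krawtchouk n k (hammingDist x y) =
        ∑ k ∈ K, c k * ∑ A ∈ Finset.powersetCard k Finset.univ,
          (∑ x ∈ S, subsetSign A x) ^ 2 := by
      simp_rw [← sum_sum_sum_sub_eq_sum_sq _ (fun (A : Finset (Fin n)) z => subsetSign A z)
        (fun A x y => subsetSign_sub A x y), sum_subsetSign, hammingNorm_sub, Finset.mul_sum]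
      rw [Finset.sum_comm (s := K)]
      exact Finset.sum_congr rfl fun x _ => Finset.sum_comm
    rw [he]
    -- Only k = 0 is kept; its single character is trivial, with sum |S|.
    refine le_trans (le_of_eq ?_) (Finset.single_le_sum (f := fun k => c k *
      ∑ A ∈ Finset.powersetCard k Finset.univ, (∑ x ∈ S, subsetSign A x) ^ 2)
      (fun k hk => mul_nonneg (hc k hk) (Finset.sum_nonneg fun A _ => sq_nonneg _)) hK)
    simp [subsetSign]
  refine hlow.trans ?_
  rw [← nsmul_eq_mul]
  refine Finset.sum_le_card_nsmul _ _ _ fun x hx => ?_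
  -- The diagonal term y = x gives the bound; all other terms are nonpositive by `hf`.
  rw [← Finset.add_sum_erase _ _ hx, hammingDist_self]
  refine add_le_of_nonpos_right (Finset.sum_nonpos fun y hy => ?_)
  obtain ⟨hne, hy⟩ := Finset.mem_erase.1 hy
  refine hf _ (hS x hx y hy hne.symm) ?_
  simpa using hammingDist_le_card_fintype (x := x) (y := y)

theorem card_le_two_hundred_fifty_six {S : Finset (V 16)}
    (hS : ∀ x ∈ S, ∀ y ∈ S, x ≠ y → 6 ≤ hammingDist x y) : S.card ≤ 256 := by
  have h := delsarte_bound hS (Finset.range 13)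
    -- A dual certificate, scaled to integers: its value at distance 0 is exactly 256 times its
    -- constant coefficient.
    (fun k => [24080, 17325, 7224, 3592, 954, 90, 0, 0, 0, 35, 0, 0, 250].getD k 0)
    (by simp) (by decide) (by
      intro w h1 h2
      interval_cases w <;> decide +kernel)
  have h0 : ∑ k ∈ Finset.range 13,
      [24080, 17325, 7224, 3592, 954, 90, 0, 0, 0, 35, 0, 0, 250].getD k 0 * krawtchouk 16 k 0 =
        24080 * 256 := by decide +kernel
  rw [h0] at h
  simp only [List.getD_cons_zero] at h
  by_contra hlt
  have : (256 : ℤ) < S.card := by exact_mod_cast not_le.1 hlt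
  nlinarith

/-! ### Residual codes and linear codes of distance six -/

theorem hammingNorm_eq_sum {ι : Type*} [Fintype ι] (x : ι → ZMod 2) :
    hammingNorm x = ∑ i, if x i ≠ 0 then 1 else 0 := by
  rw [hammingNorm, Finset.card_filter]

/-- The weights of `z` and `z - c` in terms of the restriction of `z` to the zeros of `c`. -/
theorem hammingNorm_add_hammingNorm_sub {n : ℕ} (z c : V n) :
    hammingNorm z + hammingNorm (z - c) =
      hammingNorm c + 2 * hammingNorm (fun i : {i // c i = 0} => z i) := by
  have h : ∀ a b : ZMod 2, ((if a ≠ 0 then 1 else 0) + (if a - b ≠ 0 then 1 else 0) : ℕ) =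
      (if b ≠ 0 then 1 else 0) + 2 * (if b = 0 then (if a ≠ 0 then 1 else 0) else 0) := by decide
  have hsub : ∑ i : {i // c i = 0}, (if z i ≠ 0 then 1 else 0) =
      ∑ i, if c i = 0 then (if z i ≠ 0 then 1 else 0) else 0 := by
    exact (Finset.sum_subtype (p := fun i => c i = 0)
      (Finset.univ.filter fun i => c i = 0) (by simp)
      (fun i => if z i ≠ 0 then 1 else 0)).symm.trans (Finset.sum_filter _ _)
  simp only [hammingNorm_eq_sum]
  rw [hsub, Finset.mul_sum, ← Finset.sum_add_distrib, ← Finset.sum_add_distrib]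
  exact Finset.sum_congr rfl fun i _ => h _ _

/-- Sphere packing in the residual code of a word `c` of minimum weight at least five: restricted
to the zeros of `c`, the balls of radius one cover every word at most twice. -/
theorem card_mul_le_of_minimal_weight {n : ℕ} (U : Submodule (ZMod 2) (V n)) {c : V n}
    (hc : c ∈ U) (hmin : ∀ z ∈ U, z ≠ 0 → hammingNorm c ≤ hammingNorm z)
    (hw : 5 ≤ hammingNorm c) :
    Nat.card U * (n - hammingNorm c + 1) ≤ 2 * 2 ^ (n - hammingNorm c) := by
  classical
  have hT : Fintype.card {i // c i = 0} = n - hammingNorm c := by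
    have h := Finset.card_filter_add_card_filter_not (s := (Finset.univ : Finset (Fin n)))
      (fun i => c i = 0)
    have hn : hammingNorm c = (Finset.univ.filter fun i => ¬ c i = 0).card := rfl
    rw [Finset.card_univ, Fintype.card_fin, ← hn] at h
    rw [Fintype.card_subtype]
    omega
  -- The elements of a ball of radius one: its centre and the unit vectors.
  let e : Option {i // c i = 0} → {i // c i = 0} → ZMod 2 := fun o => o.elim 0 fun i => Pi.single i 1
  have he : ∀ o, hammingNorm (e o) ≤ 1 := by
    rintro (_ | i)
    · simp [e]
    · rw [hammingNorm]
      refine (Finset.card_le_card (t := {i}) fun j hj => ?_).trans (Finset.card_singleton i).le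
      by_contra hne
      rw [Finset.mem_singleton] at hne
      simp [e, Pi.single_apply, hne] at hj
  have hinj : Function.Injective e := by
    rintro (_ | i) (_ | j) h
    · rfl
    · have := congrFun h j
      simp [e] at this
    · have := congrFun h i
      simp [e] at this
    · have := congrFun h i
      simp only [e, Option.elim, Pi.single_apply, if_true] at this
      split_ifs at this with hij
      · rw [hij]
      · exact absurd this (by decide)
  let f : U × Option {i // c i = 0} → {i // c i = 0} → ZMod 2 := fun p i => p.1.1 i + e p.2 i
  have hfib : ∀ p q : U × Option {i // c i = 0}, f p = f q → q = p ∨ q = (p.1 - ⟨c, hc⟩, p.2) := by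
    rintro ⟨x, o⟩ ⟨y, o'⟩ h
    have hz : (fun i : {i // c i = 0} => (x.1 - y.1) i) = e o' - e o := by
      funext i
      have := congrFun h i
      simp only [f] at this
      simp only [Pi.sub_apply]
      rw [sub_eq_sub_iff_add_eq_add, this, add_comm]
    have hb : hammingNorm (fun i : {i // c i = 0} => (x.1 - y.1) i) ≤ 2 := by
      have h1 := hammingDist_triangle (e o) 0 (e o')
      rw [hz, ← neg_add_eq_sub, ← hammingDist_eq_hammingNorm]
      have h2 := he o
      have h3 := he o'
      simp only [hammingDist_zero_right, hammingDist_zero_left] at h1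
      omega
    have hsum := hammingNorm_add_hammingNorm_sub (x.1 - y.1) c
    -- Otherwise z = x - y and z - c both have weight at least wt c, so the restriction of z has
    -- weight at least wt c / 2 > 2.
    have hzc : x.1 - y.1 = 0 ∨ x.1 - y.1 - c = 0 := by
      by_contra! hne
      have h1 := hmin _ (U.sub_mem x.2 y.2) hne.1
      have h2 := hmin _ (U.sub_mem (U.sub_mem x.2 y.2) hc) hne.2
      omega
    have hz0 : (fun i : {i // c i = 0} => (x.1 - y.1) i) = 0 := by
      funext i
      rcases hzc with h0 | h0
      · rw [h0]; rfl
      · rw [sub_eq_zero.1 h0]; exact i.2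
    have ho : o' = o := hinj (sub_eq_zero.1 (hz.symm.trans hz0))
    subst ho
    rcases hzc with h0 | h0
    · left
      rw [show y = x from Subtype.ext (sub_eq_zero.1 h0).symm]
    · right
      rw [show y = x - ⟨c, hc⟩ from Subtype.ext (by
        rw [sub_eq_zero] at h0
        simp [← h0])]
  have hcard := Finset.card_le_mul_card_image (f := f) Finset.univ 2 (by
    intro b hb
    obtain ⟨p, -, rfl⟩ := Finset.mem_image.1 hb
    refine (Finset.card_le_card (t := {p, (p.1 - ⟨c, hc⟩, p.2)}) fun q hq => ?_).trans
      Finset.card_le_two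
    have := hfib p q (Finset.mem_filter.1 hq).2.symm
    simpa using this)
  have himg : (Finset.univ.image f).card ≤ 2 ^ (n - hammingNorm c) := by
    refine (Finset.card_le_univ _).trans ?_
    rw [Fintype.card_fun, hT, ZMod.card]
  rw [Finset.card_univ, Fintype.card_prod, Fintype.card_option, hT, ← Nat.card_eq_fintype_card]
    at hcard
  omega

theorem card_eq_two_pow_finrank {n : ℕ} (U : Submodule (ZMod 2) (V n)) :
    Nat.card U = 2 ^ Module.finrank (ZMod 2) U := by
  rw [Module.natCard_eq_pow_finrank (K := ZMod 2), Nat.card_zmod]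

/-- Dimension 8 would give 256 words, and 256 (17 - w) ≤ 2 · 2^(16 - w) fails for every minimum
weight w from 6 to 16. -/
theorem linear_ncard_le_of_minDist_six {U : Submodule (ZMod 2) (V 16)}
    (hU : ((6 : ℕ) : ℕ∞) ≤ minDist (U : Set (V 16))) : (U : Set (V 16)).ncard ≤ 128 := by
  classical
  rw [← Nat.card_coe_set_eq]
  change Nat.card U ≤ 128
  rw [card_eq_two_pow_finrank]
  by_contra hlt
  have h8 : 8 ≤ Module.finrank (ZMod 2) U := by
    by_contra h
    have := Nat.pow_le_pow_right (n := 2) (by norm_num)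
      (show Module.finrank (ZMod 2) U ≤ 7 by omega)
    omega
  have hcard : 256 ≤ Nat.card U := by
    rw [card_eq_two_pow_finrank]
    exact Nat.pow_le_pow_right (n := 2) (by norm_num) h8
  rw [natCast_le_minDist_iff] at hU
  have hex : ∃ c : V 16, c ∈ U ∧ c ≠ 0 := by
    by_contra! h
    rw [show U = ⊥ from (Submodule.eq_bot_iff U).2 h] at hcard
    simp at hcard
  obtain ⟨c, hc, hmin⟩ := Finset.exists_min_image
    (Finset.univ.filter fun c : V 16 => c ∈ U ∧ c ≠ 0) hammingNorm
    (hex.imp fun c hc => by simpa using hc)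
  simp only [Finset.mem_filter, Finset.mem_univ, true_and] at hc hmin
  have h6 : 6 ≤ hammingNorm c := by
    simpa using hU c hc.1 0 U.zero_mem hc.2
  have h16 : hammingNorm c ≤ 16 := by simpa using hammingNorm_le_card_fintype (x := c)
  have hpack := card_mul_le_of_minimal_weight U hc.1 (fun z hz hz0 => hmin z ⟨hz, hz0⟩) (by omega)
  have := (Nat.mul_le_mul_right _ hcard).trans hpack
  generalize hammingNorm c = w at h6 h16 this
  interval_cases w <;> omega

/-! ### Codes encoded by natural numbers -/

/-- The word of length `n` given by the binary digits of `m`. -/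
def bitWord (n m : ℕ) : V n := fun i => if m.testBit i then 1 else 0

theorem bitWord_xor (n a b : ℕ) : bitWord n (a ^^^ b) = bitWord n a + bitWord n b := by
  funext i
  simp only [bitWord, Nat.testBit_xor, Pi.add_apply]
  cases a.testBit i <;> cases b.testBit i <;> decide

theorem bitWord_zero (n : ℕ) : bitWord n 0 = 0 := by
  funext i
  simp [bitWord]

/-- The number of ones among the last `n` binary digits of `m`. -/
def bitWeight : ℕ → ℕ → ℕ
  | 0, _ => 0
  | n + 1, m => bitWeight n m + (m.testBit n).toNat

theorem hammingNorm_bitWord (n m : ℕ) : hammingNorm (bitWord n m) = bitWeight n m := by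
  have h : hammingNorm (bitWord n m) = ∑ i : Fin n, (m.testBit i).toNat := by
    rw [hammingNorm_eq_sum]
    refine Finset.sum_congr rfl fun i _ => ?_
    unfold bitWord
    cases m.testBit i <;> simp
  rw [h]
  clear h
  induction n with
  | zero => rfl
  | succ n ih =>
    rw [Fin.sum_univ_castSucc, bitWeight, ← ih]
    rfl

theorem hammingDist_bitWord (n a b : ℕ) :
    hammingDist (bitWord n a) (bitWord n b) = bitWeight n (a ^^^ b) := by
  rw [← hammingNorm_bitWord, bitWord_xor, ← ZModModule.sub_eq_add, hammingNorm_sub]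

/-- The code whose words are given by the binary digits of the numbers in `L`. -/
def bitCode (n : ℕ) (L : List ℕ) : Set (V n) := {x | ∃ m ∈ L, bitWord n m = x}

/-- The words given by `L` have pairwise distance at least `d`. -/
def IsSeparated (n d : ℕ) (L : List ℕ) : Prop :=
  L.Pairwise fun a b => d ≤ bitWeight n (a ^^^ b)

theorem IsSeparated.le_minDist {n d : ℕ} {L : List ℕ} (h : IsSeparated n d L) :
    (d : ℕ∞) ≤ minDist (bitCode n L) := by
  rw [natCast_le_minDist_iff]
  rintro _ ⟨a, ha, rfl⟩ _ ⟨b, hb, rfl⟩ hne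
  have hs : Std.Symm fun a b : ℕ => bitWord n a ≠ bitWord n b → d ≤ bitWeight n (a ^^^ b) :=
    ⟨fun a b h hne => by rw [Nat.xor_comm]; exact h hne.symm⟩
  have h' : L.Pairwise fun a b => bitWord n a ≠ bitWord n b → d ≤ bitWeight n (a ^^^ b) := by
    refine List.Pairwise.imp (fun {a b} hab _ => ?_) h
    exact hab
  rw [hammingDist_bitWord]
  exact h'.forall_of_forall (fun x _ hx => absurd rfl hx) ha hb hne

/-- Positive separation makes the listed words distinct, whence the form d + 1. -/
theorem IsSeparated.ncard_bitCode {n d : ℕ} {L : List ℕ} (h : IsSeparated n (d + 1) L) :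
    (bitCode n L).ncard = L.length := by
  classical
  have hnd : (L.map (bitWord n)).Nodup := by
    rw [List.Nodup, List.pairwise_map]
    refine List.Pairwise.imp (fun {a b} hab heq => ?_) h
    rw [← hammingDist_bitWord, heq, hammingDist_self] at hab
    omega
  have : bitCode n L = ((L.map (bitWord n)).toFinset : Set (V n)) := by
    ext x
    simp [bitCode]
  rw [this, Set.ncard_coe_finset, List.toFinset_card_of_nodup hnd, List.length_map]

/-- The translates of the words in `L` by the words in `C`. -/
def cosetUnion (C L : List ℕ) : List ℕ := C.flatMap fun c => L.map (c ^^^ ·)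

/-- The span of a list of words. -/
def xorSpan : List ℕ → List ℕ
  | [] => [0]
  | g :: gs => cosetUnion [0, g] (xorSpan gs)

theorem mem_xorSpan_cons {g a : ℕ} {gs : List ℕ} :
    a ∈ xorSpan (g :: gs) ↔ a ∈ xorSpan gs ∨ ∃ b ∈ xorSpan gs, g ^^^ b = a := by
  simp [xorSpan, cosetUnion]

theorem xor_mem_xorSpan {gs : List ℕ} {a b : ℕ} (ha : a ∈ xorSpan gs) (hb : b ∈ xorSpan gs) :
    a ^^^ b ∈ xorSpan gs := by
  induction gs generalizing a b with
  | nil =>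
    simp only [xorSpan, List.mem_singleton] at *
    simp [ha, hb]
  | cons g gs ih =>
    rw [mem_xorSpan_cons] at *
    rcases ha with ha | ⟨a, ha, rfl⟩ <;> rcases hb with hb | ⟨b, hb, rfl⟩
    · exact Or.inl (ih ha hb)
    · exact Or.inr ⟨_, ih ha hb, Nat.xor_left_comm _ _ _⟩
    · exact Or.inr ⟨_, ih ha hb, (Nat.xor_assoc _ _ _).symm⟩
    · refine Or.inl ?_
      rw [Nat.xor_comm g a, Nat.xor_assoc, ← Nat.xor_assoc g g, Nat.xor_self, Nat.zero_xor]
      exact ih ha hb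

theorem zero_mem_xorSpan (gs : List ℕ) : 0 ∈ xorSpan gs := by
  induction gs with
  | nil => simp [xorSpan]
  | cons g gs ih => exact mem_xorSpan_cons.2 (Or.inl ih)

/-- Differences between two cosets of a span again form a coset, so it suffices to compare each pair
of representatives with the span. -/
theorem IsSeparated.cosetUnion {n d : ℕ} {C gs : List ℕ} (h : IsSeparated n d (xorSpan gs))
    (hC : C.Pairwise fun c c' => ∀ l ∈ xorSpan gs, d ≤ bitWeight n (c ^^^ c' ^^^ l)) :
    IsSeparated n d (cosetUnion C (xorSpan gs)) := by
  have hx : ∀ a b x y : ℕ, (a ^^^ x) ^^^ (b ^^^ y) = a ^^^ b ^^^ (x ^^^ y) := fun a b x y => by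
    rw [Nat.xor_assoc, Nat.xor_assoc, Nat.xor_left_comm x]
  refine List.pairwise_flatMap.2 ⟨fun c _ => ?_, List.Pairwise.imp (fun {c c'} hcc => ?_) hC⟩
  · rw [List.pairwise_map]
    refine List.Pairwise.imp (fun {a b} hab => ?_) h
    rwa [hx, Nat.xor_self, Nat.zero_xor]
  · simp only [List.mem_map]
    rintro _ ⟨a, ha, rfl⟩ _ ⟨b, hb, rfl⟩
    rw [hx]
    exact hcc _ (xor_mem_xorSpan ha hb)

/-- A condition on generators that ensures minimum distance `d` of their span. -/
def SpanSeparated (n d : ℕ) : List ℕ → Prop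
  | [] => True
  | g :: gs => (∀ l ∈ xorSpan gs, d ≤ bitWeight n (g ^^^ l)) ∧ SpanSeparated n d gs

theorem SpanSeparated.isSeparated {n d : ℕ} {gs : List ℕ} (h : SpanSeparated n d gs) :
    IsSeparated n d (xorSpan gs) := by
  induction gs with
  | nil => simp [xorSpan, IsSeparated]
  | cons g gs ih => exact (ih h.2).cosetUnion (by simpa using h.1)

theorem length_xorSpan (gs : List ℕ) : (xorSpan gs).length = 2 ^ gs.length := by
  induction gs with
  | nil => rfl
  | cons g gs ih => simp [xorSpan, cosetUnion, ih, pow_succ, mul_two]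

/-- The linear code spanned by a list of words. -/
def bitSubmodule (n : ℕ) (gs : List ℕ) : Submodule (ZMod 2) (V n) :=
  AddSubgroup.toZModSubmodule 2
    { carrier := bitCode n (xorSpan gs)
      zero_mem' := ⟨0, zero_mem_xorSpan gs, bitWord_zero n⟩
      add_mem' := by
        rintro _ _ ⟨a, ha, rfl⟩ ⟨b, hb, rfl⟩
        exact ⟨_, xor_mem_xorSpan ha hb, bitWord_xor n a b⟩
      neg_mem' := by
        rintro x hx
        rwa [ZModModule.neg_eq_self] }

theorem coe_bitSubmodule (n : ℕ) (gs : List ℕ) :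
    (bitSubmodule n gs : Set (V n)) = bitCode n (xorSpan gs) := rfl

theorem SpanSeparated.two_pow_le_maxLinearCodeSize {n d : ℕ} {gs : List ℕ}
    (h : SpanSeparated n (d + 1) gs) : 2 ^ gs.length ≤ maxLinearCodeSize n (d + 1) := by
  rw [← length_xorSpan, ← h.isSeparated.ncard_bitCode, ← coe_bitSubmodule]
  exact ncard_le_maxLinearCodeSize h.isSeparated.le_minDist

theorem ncard_eq_card_toFinset {n : ℕ} (S : Set (V n)) :
    ∃ T : Finset (V n), (T : Set (V n)) = S ∧ T.card = S.ncard := by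
  classical
  exact ⟨S.toFinset, by simp, (Set.ncard_eq_toFinset_card' S).symm⟩

theorem maxCodeSize_le {n d M : ℕ}
    (h : ∀ S : Finset (V n), (∀ x ∈ S, ∀ y ∈ S, x ≠ y → d ≤ hammingDist x y) → S.card ≤ M) :
    maxCodeSize n d ≤ M := by
  obtain ⟨S, hS, hc⟩ := exists_ncard_eq_maxCodeSize n d
  obtain ⟨T, rfl, hT⟩ := ncard_eq_card_toFinset S
  rw [← hc, ← hT]
  exact h T (natCast_le_minDist_iff.1 hS)

/-! ### The extremal codes of lengths 8 and 16 -/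

theorem maxCodeSize_eight_three : maxCodeSize 8 3 = 20 := by
  refine le_antisymm (maxCodeSize_le fun S hS => card_le_twenty hS) ?_
  have h : IsSeparated 8 3 [0, 23, 25, 35, 45, 62, 79, 92, 100, 106, 113, 139, 140, 166, 181, 184,
      194, 197, 233, 255] := by
    unfold IsSeparated
    decide +kernel
  exact h.ncard_bitCode.symm.le.trans (ncard_le_maxCodeSize h.le_minDist)

/-- A linear code has a power of two as its size, and 16 is the largest one not above 20. -/
theorem maxLinearCodeSize_eight_three : maxLinearCodeSize 8 3 = 16 := by
  refine le_antisymm ?_ ?_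
  · obtain ⟨U, hU, hc⟩ := exists_ncard_eq_maxLinearCodeSize 8 3
    have h20 := ncard_le_maxCodeSize hU
    rw [maxCodeSize_eight_three, ← Nat.card_coe_set_eq] at h20
    rw [← hc, ← Nat.card_coe_set_eq]
    change Nat.card U ≤ 20 at h20
    change Nat.card U ≤ 16
    rw [card_eq_two_pow_finrank] at *
    by_contra hlt
    have h5 : 5 ≤ Module.finrank (ZMod 2) U := by
      by_contra h
      have := Nat.pow_le_pow_right (n := 2) (by norm_num)
        (show Module.finrank (ZMod 2) U ≤ 4 by omega)
      omega
    have := Nat.pow_le_pow_right (n := 2) (by norm_num) h5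
    omega
  -- The constant 1 and the coordinate functions on 𝔽₂³: the extended Hamming code.
  · have h : SpanSeparated 8 3 [255, 170, 204, 240] := by
      simp only [SpanSeparated]
      decide +kernel
    exact h.two_pow_le_maxLinearCodeSize

/-- The affine functions on `𝔽₂⁴`, as words of length sixteen: generators of the first order
Reed–Muller code. -/
def reedMullerGens : List ℕ := [65535, 43690, 52428, 61680, 65280]

/-- Quadratic forms on `𝔽₂⁴` whose differences all have full rank. -/
def kerdockForms : List ℕ := [0, 27328, 50848, 9448, 29224, 47176, 7816, 23648]

/-- The Nordstrom–Robinson code. -/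
def nordstromRobinson : Set (V 16) := bitCode 16 (cosetUnion kerdockForms (xorSpan reedMullerGens))

/-- Affine functions on 𝔽₂⁴ are at distance at least 8 from each other. A quadratic form of full
rank is bent, hence at distance at least 6 from all of them, and the differences of the coset
representatives are such forms. -/
theorem isSeparated_nordstromRobinson :
    IsSeparated 16 6 (cosetUnion kerdockForms (xorSpan reedMullerGens)) := by
  have h : SpanSeparated 16 6 reedMullerGens := by
    simp only [SpanSeparated, reedMullerGens]
    decide +kernel
  exact h.isSeparated.cosetUnion (by decide +kernel)

theorem ncard_nordstromRobinson : nordstromRobinson.ncard = 256 :=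
  isSeparated_nordstromRobinson.ncard_bitCode.trans (by decide +kernel)

theorem le_minDist_nordstromRobinson : ((6 : ℕ) : ℕ∞) ≤ minDist nordstromRobinson :=
  isSeparated_nordstromRobinson.le_minDist

theorem maxCodeSize_sixteen_six : maxCodeSize 16 6 = 256 :=
  le_antisymm (maxCodeSize_le fun _ hS => card_le_two_hundred_fifty_six hS)
    (ncard_nordstromRobinson.symm.le.trans (ncard_le_maxCodeSize le_minDist_nordstromRobinson))

theorem maxLinearCodeSize_sixteen_six : maxLinearCodeSize 16 6 = 128 := by
  refine le_antisymm ?_ ?_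
  · obtain ⟨U, hU, hc⟩ := exists_ncard_eq_maxLinearCodeSize 16 6
    rw [← hc]
    exact linear_ncard_le_of_minDist_six hU
  -- The nonzero combinations of the two added forms remain at distance at least 6 from the affine
  -- functions, which gives dimension 7.
  · have h : SpanSeparated 16 6 (27328 :: 50848 :: reedMullerGens) := by
      simp only [SpanSeparated, reedMullerGens]
      decide +kernel
    exact h.two_pow_le_maxLinearCodeSize

/-! ### Excluding independent sets by greedy clique covers -/

section CliqueCover

variable (adj : ℕ → ℕ → Bool)

/-- Removes from a list the clique, extending the clique `Q`, that is found greedily. -/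
def peelClique : List ℕ → List ℕ → List ℕ
  | _, [] => []
  | Q, v :: P => bif Q.all (adj v) then peelClique (v :: Q) P else v :: peelClique Q P

/-- Removes `k` greedily found cliques from a list. -/
def peelCliques : ℕ → List ℕ → List ℕ
  | 0, P => P
  | k + 1, P => peelCliques k (peelClique adj [] P)

/-- Checks with `f` the non-neighbours in `P` of each vertex in a list, each vertex being deleted
from `P` when it has been dealt with. -/
def branchVertices (f : List ℕ → Bool) : List ℕ → List ℕ → Bool
  | _, [] => true
  | P, v :: R => f (P.filter fun u => !adj v u) && branchVertices f (P.filter fun u => !u.beq v) R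

/-- A sufficient test for a list to contain no independent set of a given size. -/
def noIndepSet : ℕ → List ℕ → Bool
  | 0, _ => false
  | k + 1, P => branchVertices adj (noIndepSet k) P (peelCliques adj k P)

/-- Distinct elements of `A` are not adjacent. -/
def IsIndep (A : Finset ℕ) : Prop := ∀ a ∈ A, ∀ b ∈ A, a ≠ b → adj a b = false

variable {adj}

theorem IsIndep.mono {A B : Finset ℕ} (h : IsIndep adj B) (hAB : A ⊆ B) : IsIndep adj A :=
  fun a ha b hb => h a (hAB ha) b (hAB hb)

/-- The clique consists of `Q` and the removed vertices. Each was tested against its predecessors in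
one order only, hence the symmetrized adjacency. -/
theorem exists_clique_peelClique (Q P : List ℕ) (hQ : ∀ a ∈ Q, ∀ b ∈ Q, a ≠ b → adj a b ∨ adj b a) :
    ∃ C : Set ℕ, (∀ a ∈ C, ∀ b ∈ C, a ≠ b → adj a b ∨ adj b a) ∧ (∀ a ∈ Q, a ∈ C) ∧
      ∀ a ∈ P, a ∈ C ∨ a ∈ peelClique adj Q P := by
  induction P generalizing Q with
  | nil => exact ⟨{a | a ∈ Q}, hQ, fun a ha => ha, by simp⟩
  | cons v P ih =>
    rw [peelClique]
    cases hv : Q.all (adj v) with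
    | true =>
      rw [List.all_eq_true] at hv
      obtain ⟨C, hC, hQC, hP⟩ := ih (v :: Q) (by
        intro a ha b hb hne
        rw [List.mem_cons] at ha hb
        rcases ha with rfl | ha' <;> rcases hb with rfl | hb'
        · exact absurd rfl hne
        · exact Or.inl (hv b hb')
        · exact Or.inr (hv a ha')
        · exact hQ a ha' b hb' hne)
      refine ⟨C, hC, fun a ha => hQC a (List.mem_cons_of_mem _ ha), fun a ha => ?_⟩
      rcases List.mem_cons.1 ha with rfl | ha
      · exact Or.inl (hQC _ List.mem_cons_self)
      · exact hP a ha
    | false =>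
      obtain ⟨C, hC, hQC, hP⟩ := ih Q hQ
      refine ⟨C, hC, hQC, fun a ha => ?_⟩
      rcases List.mem_cons.1 ha with rfl | ha
      · exact Or.inr List.mem_cons_self
      · exact (hP a ha).imp_right (List.mem_cons_of_mem _)

/-- An independent set meets each clique at most once, so k cliques cannot exhaust more than k of
its vertices. -/
theorem IsIndep.exists_mem_peelCliques {A : Finset ℕ} (hA : IsIndep adj A) {k : ℕ} {P : List ℕ}
    (hAP : ∀ a ∈ A, a ∈ P) (hk : k < A.card) : ∃ a ∈ A, a ∈ peelCliques adj k P := by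
  classical
  induction k generalizing A P with
  | zero =>
    obtain ⟨a, ha⟩ := Finset.card_pos.1 hk
    exact ⟨a, ha, hAP a ha⟩
  | succ k ih =>
    obtain ⟨C, hC, -, hP⟩ := exists_clique_peelClique (adj := adj) [] P (by simp)
    have hone : (A.filter fun a => a ∉ peelClique adj [] P).card ≤ 1 := by
      rw [Finset.card_le_one]
      intro a ha b hb
      rw [Finset.mem_filter] at ha hb
      by_contra hne
      have ha' := (hP a (hAP a ha.1)).resolve_right ha.2
      have hb' := (hP b (hAP b hb.1)).resolve_right hb.2
      have h1 := hA a ha.1 b hb.1 hne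
      have h2 := hA b hb.1 a ha.1 (Ne.symm hne)
      have h3 := hC a ha' b hb' hne
      simp [h1, h2] at h3
    have hsum := Finset.card_filter_add_card_filter_not (s := A)
      (fun a => a ∈ peelClique adj [] P)
    obtain ⟨a, ha, hmem⟩ := ih (hA.mono (Finset.filter_subset (fun a => a ∈ peelClique adj [] P) A))
      (fun a ha => (Finset.mem_filter.1 ha).2) (by omega)
    exact ⟨a, (Finset.mem_filter.1 ha).1, hmem⟩

/-- If w were in `A`, the rest of `A` would be an independent k-set among the non-neighbours of w.
So w is not in `A`, and may be deleted from `P`. -/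
theorem branchVertices_sound {f : List ℕ → Bool} {k : ℕ}
    (hf : ∀ P, f P = true → ∀ A : Finset ℕ, IsIndep adj A → A.card = k → ¬ ∀ a ∈ A, a ∈ P)
    (R P : List ℕ) (h : branchVertices adj f P R = true) {A : Finset ℕ} (hA : IsIndep adj A)
    (hk : A.card = k + 1) (hAP : ∀ a ∈ A, a ∈ P) (v : ℕ) (hv : v ∈ A) : v ∉ R := by
  induction R generalizing P with
  | nil => simp
  | cons w R ih =>
    rw [branchVertices, Bool.and_eq_true] at h
    have hw : w ∉ A := fun hw => by
      refine hf _ h.1 (A.erase w) (hA.mono (Finset.erase_subset _ _))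
        (by rw [Finset.card_erase_of_mem hw, hk]; rfl) fun a ha => ?_
      obtain ⟨hne, ha⟩ := Finset.mem_erase.1 ha
      simp [hAP a ha, hA w hw a ha hne.symm]
    intro hmem
    rcases List.mem_cons.1 hmem with rfl | hmem
    · exact hw hv
    · refine ih _ h.2 (fun a ha => ?_) hmem
      have : a ≠ w := fun h => hw (h ▸ ha)
      simpa [hAP a ha] using Bool.eq_false_iff.2 fun h => this (Nat.eq_of_beq_eq_true h)

theorem noIndepSet_sound {k : ℕ} {P : List ℕ} (h : noIndepSet adj k P = true) {A : Finset ℕ}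
    (hA : IsIndep adj A) (hk : A.card = k) : ¬ ∀ a ∈ A, a ∈ P := by
  induction k generalizing P A with
  | zero => simp [noIndepSet] at h
  | succ k ih =>
    intro hAP
    obtain ⟨a, ha, hmem⟩ := hA.exists_mem_peelCliques hAP (k := k) (by omega)
    exact branchVertices_sound (fun P hP A hA hk => ih hP hA hk) _ _ h hA hk hAP a ha hmem

end CliqueCover

/-! ### Search up to translation and rotation -/

/-- Adjacency in the Cayley graph whose connection set has characteristic vector `M`. -/
def maskAdj (M a b : ℕ) : Bool := M.testBit (a ^^^ b)

/-- Cyclic rotation of eight bits. -/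
def rotateByte (m : ℕ) : ℕ := ((m <<< 1) &&& 255) ^^^ (m >>> 7)

theorem rotateByte_xor (a b : ℕ) : rotateByte (a ^^^ b) = rotateByte a ^^^ rotateByte b := by
  unfold rotateByte
  rw [Nat.shiftLeft_xor_distrib, Nat.and_xor_distrib_right, Nat.shiftRight_xor_distrib,
    Nat.xor_assoc, Nat.xor_assoc, Nat.xor_left_comm (b <<< 1 &&& 255)]

theorem rotateByte_lt : ∀ m < 256, rotateByte m < 256 := by decide +kernel

theorem rotateByte_iterate_eight : ∀ m < 256, rotateByte^[8] m = m := by decide +kernel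

/-- The characteristic vector of the first `k` rotations of `r`. -/
def rotationMask : ℕ → ℕ → ℕ
  | 0, _ => 0
  | k + 1, r => (1 <<< r) ||| rotationMask k (rotateByte r)

theorem exists_of_testBit_rotationMask {k r m : ℕ} (h : (rotationMask k r).testBit m = true) :
    ∃ i < k, rotateByte^[i] r = m := by
  induction k generalizing r with
  | zero => simp [rotationMask] at h
  | succ k ih =>
    rw [rotationMask, Nat.testBit_or, Bool.or_eq_true, Nat.one_shiftLeft,
      Nat.testBit_two_pow] at h
    rcases h with h | h
    · exact ⟨0, by omega, by simpa using h⟩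
    · obtain ⟨i, hi, rfl⟩ := ih h
      exact ⟨i + 1, by omega, by rw [Function.iterate_succ_apply]⟩

/-- A sufficient test for independent sets to have fewer than `k + 2` elements in the Cayley graph
on bytes whose connection set is given by a rotation invariant mask `M`. Differences are treated up
to rotation, one representative after the other. -/
def boundIndep (k : ℕ) : ℕ → List ℕ → Bool
  | M, [] => (List.range 256).all fun m => M.testBit m
  | M, r :: rs =>
    (List.range 256).all (fun m => M.testBit (rotateByte m) == M.testBit m) &&
    noIndepSet (maskAdj M) k
      ((List.range 256).filter fun m => !M.testBit m && !M.testBit (m ^^^ r)) &&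
    boundIndep k (M ||| rotationMask 8 r) rs

theorem rotateByte_iterate_xor (j a b : ℕ) :
    rotateByte^[j] (a ^^^ b) = rotateByte^[j] a ^^^ rotateByte^[j] b := by
  induction j generalizing a b with
  | zero => rfl
  | succ j ih => simp only [Function.iterate_succ_apply, rotateByte_xor, ih]

theorem rotateByte_iterate_lt (j : ℕ) {m : ℕ} (hm : m < 256) : rotateByte^[j] m < 256 := by
  induction j generalizing m with
  | zero => exact hm
  | succ j ih => exact ih (rotateByte_lt m hm)

theorem testBit_rotateByte_iterate {M : ℕ}
    (hM : ∀ m < 256, M.testBit (rotateByte m) = M.testBit m) (j : ℕ) {m : ℕ} (hm : m < 256) :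
    M.testBit (rotateByte^[j] m) = M.testBit m := by
  induction j generalizing m with
  | zero => rfl
  | succ j ih => rw [Function.iterate_succ_apply, ih (rotateByte_lt m hm), hM m hm]

theorem xor_lt_256 {a b : ℕ} (ha : a < 256) (hb : b < 256) : a ^^^ b < 256 :=
  Nat.xor_lt_two_pow (n := 8) ha hb

/-- Translating and rotating, an independent set with two elements whose difference is a rotation
of `r` can be assumed to contain `0` and `r`. -/
theorem IsIndep.exists_of_xor_eq_rotate {M : ℕ}
    (hM : ∀ m < 256, M.testBit (rotateByte m) = M.testBit m) {A : Finset ℕ}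
    (hA : IsIndep (maskAdj M) A) (hA256 : ∀ a ∈ A, a < 256) {r i a b : ℕ} (hr : r < 256)
    (hi : i < 8) (ha : a ∈ A) (hb : b ∈ A) (hab : rotateByte^[i] r = a ^^^ b) :
    ∃ B : Finset ℕ, IsIndep (maskAdj M) B ∧ (∀ x ∈ B, x < 256) ∧ B.card = A.card ∧ 0 ∈ B ∧
      r ∈ B := by
  classical
  -- Translating by b and completing the i rotations to a full turn sends b to 0 and a to r.
  let f : ℕ → ℕ := fun x => rotateByte^[8 - i] (x ^^^ b)
  have hf : ∀ x y, f x ^^^ f y = rotateByte^[8 - i] (x ^^^ y) := fun x y => by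
    simp only [f]
    rw [← rotateByte_iterate_xor, Nat.xor_comm y b, Nat.xor_assoc, ← Nat.xor_assoc b,
      Nat.xor_self, Nat.zero_xor]
  have hz : ∀ j, rotateByte^[j] 0 = 0 := fun j => Function.iterate_fixed (by decide) j
  have hinj : Set.InjOn f A := by
    intro x hx y hy hxy
    have h1 : rotateByte^[8 - i] (x ^^^ y) = 0 := by rw [← hf, hxy, Nat.xor_self]
    have h2 : rotateByte^[8] (x ^^^ y) = 0 := by
      rw [show 8 = i + (8 - i) by omega, Function.iterate_add_apply, h1, hz]
    rw [rotateByte_iterate_eight _ (xor_lt_256 (hA256 x hx) (hA256 y hy))] at h2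
    exact Nat.xor_eq_zero_iff.1 h2
  refine ⟨A.image f, ?_, ?_, Finset.card_image_of_injOn hinj, ?_, ?_⟩
  · intro u hu v hv hne
    obtain ⟨x, hx, rfl⟩ := Finset.mem_image.1 hu
    obtain ⟨y, hy, rfl⟩ := Finset.mem_image.1 hv
    rw [maskAdj, hf, testBit_rotateByte_iterate hM _ (xor_lt_256 (hA256 x hx) (hA256 y hy))]
    exact hA x hx y hy fun h => hne (by rw [h])
  · intro u hu
    obtain ⟨x, hx, rfl⟩ := Finset.mem_image.1 hu
    exact rotateByte_iterate_lt _ (xor_lt_256 (hA256 x hx) (hA256 b hb))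
  · exact Finset.mem_image.2 ⟨b, hb, by simp only [f]; rw [Nat.xor_self, hz]⟩
  · refine Finset.mem_image.2 ⟨a, ha, ?_⟩
    simp only [f]
    rw [← hab, ← Function.iterate_add_apply, show 8 - i + i = 8 by omega,
      rotateByte_iterate_eight _ hr]

/-- If a difference in `A` is a rotation of r, a symmetry puts 0 and r into the set, and its other k
elements contradict `noIndepSet`. Otherwise the whole class of r can be added to the connection set,
keeping `A` independent. At the end every difference is forbidden. -/
theorem boundIndep_sound {k M : ℕ} {rs : List ℕ} (h : boundIndep k M rs = true)
    (hrs : ∀ r ∈ rs, r < 256) {A : Finset ℕ} (hA : IsIndep (maskAdj M) A)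
    (hA256 : ∀ a ∈ A, a < 256) : A.card ≠ k + 2 := by
  classical
  induction rs generalizing M with
  | nil =>
    intro hk
    obtain ⟨a, ha, b, hb, hne⟩ := Finset.one_lt_card.1 (show 1 < A.card by omega)
    rw [boundIndep, List.all_eq_true] at h
    have h1 := h _ (List.mem_range.2 (xor_lt_256 (hA256 a ha) (hA256 b hb)))
    have h2 := hA a ha b hb hne
    rw [maskAdj, h1] at h2
    exact absurd h2 (by decide)
  | cons r rs ih =>
    intro hk
    rw [boundIndep, Bool.and_eq_true, Bool.and_eq_true, List.all_eq_true] at h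
    obtain ⟨⟨hM, hs⟩, hrec⟩ := h
    have hM' : ∀ m < 256, M.testBit (rotateByte m) = M.testBit m := fun m hm => by
      simpa using hM m (List.mem_range.2 hm)
    have hr := hrs r List.mem_cons_self
    refine ih hrec (fun x hx => hrs x (List.mem_cons_of_mem _ hx)) ?_ hk
    intro a ha b hb hne
    rw [maskAdj, Nat.testBit_or, show M.testBit (a ^^^ b) = false from hA a ha b hb hne,
      Bool.false_or]
    by_contra hbit
    obtain ⟨i, hi, hab⟩ := exists_of_testBit_rotationMask (Bool.not_eq_false _ ▸ hbit)
    obtain ⟨B, hB, hB256, hcard, h0, hrB⟩ := hA.exists_of_xor_eq_rotate hM' hA256 hr hi ha hb hab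
    have hr0 : r ≠ 0 := by
      rintro rfl
      rw [Function.iterate_fixed (by decide)] at hab
      exact hne (Nat.xor_eq_zero_iff.1 hab.symm)
    refine noIndepSet_sound hs
      (hB.mono ((Finset.erase_subset r _).trans (Finset.erase_subset 0 B))) ?_ ?_
    · rw [Finset.card_erase_of_mem (Finset.mem_erase.2 ⟨hr0, hrB⟩), Finset.card_erase_of_mem h0]
      omega
    · intro x hx
      simp only [Finset.mem_erase] at hx
      have h1 := hB x hx.2.2 0 h0 hx.2.1
      have h2 := hB x hx.2.2 r hrB hx.1
      rw [maskAdj, Nat.xor_zero] at h1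
      rw [maskAdj] at h2
      simp [h1, h2, hB256 x hx.2.2]

/-! ### The ring of eight qubits -/

/-- The characteristic vector of the differences of correlated errors on a ring of eight qubits. -/
def ringMask : ℕ := 0x100030101115f00030003030333ff0101115f0101115f115f115f5f5fffff

/-- The 36 rotation classes of bytes split into 14 inside the mask and 22 outside; the list has one
representative of each of the latter. -/
theorem boundIndep_ring : boundIndep 8 ringMask
    [127, 111, 95, 63, 87, 91, 43, 47, 53, 55, 59, 61, 31, 23, 29, 45, 21, 37, 39, 119, 85, 255] =
      true := by
  decide +kernel

/-- The labels of the correlated errors on a ring of eight qubits. -/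
def ringErrors : List ℕ :=
  0 :: (List.finRange 8).map (fun i => 2 ^ i.val) ++
    (List.finRange 8).map (fun i => 2 ^ i.val ^^^ 2 ^ (finRotate 8 i).val)

theorem bitWord_two_pow (i : Fin 8) : bitWord 8 (2 ^ i.val) = Pi.single i 1 := by
  revert i
  decide +kernel

theorem corrErrors_eight : corrErrors 8 = bitCode 8 ringErrors := by
  ext x
  simp only [corrErrors, bitCode, ringErrors, Set.mem_union, Set.mem_singleton_iff, Set.mem_range,
    Set.mem_ofPred_eq, List.mem_append, List.mem_cons, List.mem_map, List.mem_finRange, true_and,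
    or_and_right, exists_or, exists_eq_left, bitWord_zero, exists_exists_eq_and, bitWord_xor,
    bitWord_two_pow, eq_comm (a := x)]

theorem exists_bitWord_eq (x : V 8) : ∃ m < 256, bitWord 8 m = x := by
  refine ⟨Nat.ofBits fun i => decide (x i ≠ 0), Nat.ofBits_lt_two_pow _, ?_⟩
  funext i
  have h : ∀ a : ZMod 2, (if decide (a ≠ 0) = true then (1 : ZMod 2) else 0) = a := by decide
  rw [bitWord, Nat.testBit_ofBits_lt _ _ i.isLt]
  exact h (x i)

theorem bitWeight_ne_zero : ∀ m < 256, m ≠ 0 → bitWeight 8 m ≠ 0 := by decide +kernel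

theorem bitWord_injOn {a b : ℕ} (ha : a < 256) (hb : b < 256) (h : bitWord 8 a = bitWord 8 b) :
    a = b := by
  by_contra hne
  refine bitWeight_ne_zero (a ^^^ b) (xor_lt_256 ha hb)
    (fun h0 => hne (Nat.xor_eq_zero_iff.1 h0)) ?_
  rw [← hammingDist_bitWord, h, hammingDist_self]

theorem bitWord_mem_corrErrors_sub {m : ℕ} (hm : m < 256) :
    bitWord 8 m ∈ corrErrors 8 - corrErrors 8 ↔ ringMask.testBit m = true := by
  have h1 : ∀ m < 256, ringMask.testBit m = true → ∃ a ∈ ringErrors, ∃ b ∈ ringErrors,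
      m = a ^^^ b := by decide +kernel
  have h2 : ∀ a ∈ ringErrors, ∀ b ∈ ringErrors, a ^^^ b < 256 ∧
      ringMask.testBit (a ^^^ b) = true := by decide +kernel
  rw [corrErrors_eight]
  constructor
  · rintro ⟨_, ⟨a, ha, rfl⟩, _, ⟨b, hb, rfl⟩, h⟩
    obtain ⟨hlt, hbit⟩ := h2 a ha b hb
    simp only [ZModModule.sub_eq_add, ← bitWord_xor] at h
    rwa [← bitWord_injOn hlt hm h]
  · intro h
    obtain ⟨a, ha, b, hb, rfl⟩ := h1 m hm h
    rw [bitWord_xor, ← ZModModule.sub_eq_add]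
    exact Set.sub_mem_sub ⟨a, ha, rfl⟩ ⟨b, hb, rfl⟩

theorem ncard_le_nine_of_differenceFree {S : Set (V 8)} (hS : DifferenceFree S (corrErrors 8)) :
    S.ncard ≤ 9 := by
  classical
  by_contra hlt
  obtain ⟨T, hTS, hT⟩ := Set.exists_subset_card_eq (show 10 ≤ S.ncard by omega)
  choose label hlt' hlabel using exists_bitWord_eq
  have hfin : T.Finite := Set.toFinite T
  let A : Finset ℕ := hfin.toFinset.image label
  have hinj : Function.Injective label := fun x y h => by rw [← hlabel x, h, hlabel]
  have hcard : A.card = 10 := by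
    rw [Finset.card_image_of_injective _ hinj, ← Set.ncard_eq_toFinset_card T hfin, hT]
  have hmem : ∀ a ∈ A, ∃ x ∈ S, label x = a := fun a ha => by
    obtain ⟨x, hx, rfl⟩ := Finset.mem_image.1 ha
    exact ⟨x, hTS (hfin.mem_toFinset.1 hx), rfl⟩
  -- The excluded size is 10 = 8 + 2: eight vertices besides 0 and r.
  refine boundIndep_sound boundIndep_ring (by decide) (A := A) ?_ ?_ hcard
  · intro a ha b hb hne
    obtain ⟨x, hx, rfl⟩ := hmem a ha
    obtain ⟨y, hy, rfl⟩ := hmem b hb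
    have h := hS x hx y hy fun h => hne (by rw [h])
    rw [← hlabel x, ← hlabel y, ZModModule.sub_eq_add, ← bitWord_xor,
      bitWord_mem_corrErrors_sub (xor_lt_256 (hlt' x) (hlt' y))] at h
    exact Bool.eq_false_iff.2 h
  · intro a ha
    obtain ⟨x, -, rfl⟩ := hmem a ha
    exact hlt' x

/-- A largest code correcting the correlated errors on a ring of eight qubits. -/
def ringCode : List ℕ := [0, 255, 226, 197, 182, 139, 113, 90, 45]

theorem differenceFree_ringCode : DifferenceFree (bitCode 8 ringCode) (corrErrors 8) := by
  have h : ∀ a ∈ ringCode, ∀ b ∈ ringCode, a ≠ b →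
      a ^^^ b < 256 ∧ ringMask.testBit (a ^^^ b) = false := by decide +kernel
  rintro _ ⟨a, ha, rfl⟩ _ ⟨b, hb, rfl⟩ hne
  obtain ⟨hlt, hbit⟩ := h a ha b hb fun h => hne (by rw [h])
  rw [ZModModule.sub_eq_add, ← bitWord_xor, bitWord_mem_corrErrors_sub hlt, hbit]
  decide

theorem ncard_ringCode : (bitCode 8 ringCode).ncard = 9 := by
  have h : IsSeparated 8 1 ringCode := by
    unfold IsSeparated
    decide +kernel
  exact h.ncard_bitCode

theorem maxLogicalDim_corrErrors_eight : maxLogicalDim (corrErrors 8) = 9 := by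
  refine IsGreatest.csSup_eq ⟨⟨_, differenceFree_ringCode.correctsPhase,
    (logicalDim_eq_ncard _).trans ncard_ringCode⟩, ?_⟩
  rintro _ ⟨S, hS, rfl⟩
  rw [logicalDim_eq_ncard]
  exact ncard_le_nine_of_differenceFree (correctsPhase_iff.1 hS)

theorem exists_submodule_subset_corrErrors_sub :
    ∃ W : Submodule (ZMod 2) (V 8), Module.finrank (ZMod 2) W = 3 ∧
      (W : Set (V 8)) ⊆ corrErrors 8 - corrErrors 8 := by
  -- The span of three consecutive unit vectors; for instance e₀ + e₁ + e₂ = (e₀ + e₁) - e₂ and e₀ +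
  -- e₂ = e₀ - e₂.
  refine ⟨bitSubmodule 8 [1, 2, 4], ?_, ?_⟩
  · have h : SpanSeparated 8 1 [1, 2, 4] := by
      simp only [SpanSeparated]
      decide +kernel
    have hc := h.isSeparated.ncard_bitCode
    rw [length_xorSpan, ← coe_bitSubmodule, ← Nat.card_coe_set_eq] at hc
    change Nat.card (bitSubmodule 8 [1, 2, 4]) = 2 ^ 3 at hc
    rw [card_eq_two_pow_finrank] at hc
    exact Nat.pow_right_injective le_rfl hc
  · rw [coe_bitSubmodule]
    rintro _ ⟨m, hm, rfl⟩
    have h : ∀ m ∈ xorSpan [1, 2, 4], m < 256 ∧ ringMask.testBit m = true := by decide +kernel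
    exact (bitWord_mem_corrErrors_sub (h m hm).1).2 (h m hm).2

/-! ### Assembly -/

theorem theorem8p5 :
    -- (i) uniform phase noise
    ((∀ n t : ℕ, maxLogicalDim (weightBall n t) = maxCodeSize n (2 * t + 1)) ∧
      (∀ n t : ℕ, maxLinearCodeSize n (2 * t + 1) < maxCodeSize n (2 * t + 1) →
        ∃ S : Set (V n), CorrectsPhase S (weightBall n t) ∧ ¬ IsAffineSupport S ∧
          ∀ S' : Set (V n), IsAffineSupport S' → CorrectsPhase S' (weightBall n t) →
            logicalDim S' < logicalDim S) ∧
      (maxLinearCodeSize 8 3 = 16 ∧ maxCodeSize 8 3 = 20) ∧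
      (maxLinearCodeSize 16 6 = 128 ∧ maxCodeSize 16 6 = 256) ∧
      (∃ S : Set (V 16), 6 ≤ minDist S ∧ CorrectsPhase S (weightBall 16 2) ∧
        ¬ IsAffineSupport S ∧ logicalDim S = 256) ∧
      (∀ S : Set (V 16), IsAffineSupport S → 6 ≤ minDist S → logicalDim S ≤ 128)) ∧
    -- (ii) correlated phase noise
    ((∀ n : ℕ, maxLogicalDim (corrErrors n) = (noiseGraph (corrErrors n)).indepNum) ∧
      (noiseGraph (corrErrors 8)).indepNum = 9 ∧
      maxLogicalDim (weightBall 8 1) = 20 ∧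
      maxLogicalDim (corrErrors 8) = 9 ∧
      (∃ W : Submodule (ZMod 2) (V 8), Module.finrank (ZMod 2) W = 3 ∧
        (W : Set (V 8)) ⊆ corrErrors 8 - corrErrors 8) ∧
      maxLogicalDim (corrErrors 8) ≤ 2 ^ (8 - 3)) ∧
    -- (iii) threshold preservation
    ((∀ (n t : ℕ) (S : Set (V n)),
        CorrectsPhase S (weightBall n t) ↔ ((2 * t + 1 : ℕ) : ℕ∞) ≤ minDist S) ∧
      (∀ (n t : ℕ) (S : Set (V n)), S.Nonempty →
        (CorrectsPhase S (weightBall n t) ↔ (S - S) ∩ weightBall n (2 * t) = {0})) ∧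
      (∀ (n : ℕ) (S : Set (V n)) (p : ℝ), 0 ≤ p → p ≤ 1 →
        thresholdProb S p = corrProb n (correctionRadius S) p) ∧
      (∀ (n : ℕ) (S S' : Set (V n)),
        (∀ t : ℕ, ((2 * t + 1 : ℕ) : ℕ∞) ≤ minDist S ↔ ((2 * t + 1 : ℕ) : ℕ∞) ≤ minDist S') →
        ∀ p : ℝ, 0 ≤ p → p ≤ 1 → thresholdProb S p = thresholdProb S' p)) := by
  refine ⟨⟨maxLogicalDim_weightBall, fun _ _ => exists_nonaffine_of_maxLinearCodeSize_lt,
    ⟨maxLinearCodeSize_eight_three, maxCodeSize_eight_three⟩,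
    ⟨maxLinearCodeSize_sixteen_six, maxCodeSize_sixteen_six⟩, ?_, ?_⟩,
    ⟨fun n => maxLogicalDim_eq_indepNum _, ?_, ?_, maxLogicalDim_corrErrors_eight,
      exists_submodule_subset_corrErrors_sub, ?_⟩,
    correctsPhase_weightBall_iff, correctsPhase_weightBall_iff_inter,
    fun n S p _ _ => thresholdProb_eq_corrProb S p, ?_⟩
  · refine ⟨nordstromRobinson, le_minDist_nordstromRobinson, ?_, fun ha => ?_, ?_⟩
    · rw [correctsPhase_weightBall_iff]
      exact le_trans (by norm_num) le_minDist_nordstromRobinson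
    · have := ncard_le_maxLinearCodeSize_of_isAffineSupport ha le_minDist_nordstromRobinson
      rw [ncard_nordstromRobinson, maxLinearCodeSize_sixteen_six] at this
      omega
    · rw [logicalDim_eq_ncard, ncard_nordstromRobinson]
  · intro S ha hd
    rw [logicalDim_eq_ncard, ← maxLinearCodeSize_sixteen_six]
    exact ncard_le_maxLinearCodeSize_of_isAffineSupport ha hd
  · rw [← maxLogicalDim_eq_indepNum, maxLogicalDim_corrErrors_eight]
  · rw [maxLogicalDim_weightBall, maxCodeSize_eight_three]
  -- The exact value 9 already lies below 32, so the subspace is not needed for this bound.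
  · rw [maxLogicalDim_corrErrors_eight]
    norm_num
  · intro n S S' h p _ _
    rw [thresholdProb_eq_corrProb, thresholdProb_eq_corrProb, correctionRadius_congr h]
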